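/- Let $n\in\mathbb N$, let $1\le p<n$ be real (so $n\ge 2$), and let $p^*=\frac{np}{n-p}$. Let $\mathbb T^n=\mathbb R^n/\mathbb Z^n$ with Lebesgue measure $dx$ of total mass one. Let $(u_k)_{k\in\mathbb N}$ be a bounded sequence of real-valued functions in $W^{1,p}(\mathbb T^n)$, with weak gradients $Du_k$, and suppose that $$|u_k|^{p^*}\,dx \overset{*}{\rightharpoonup} g\,dx+\mu^s$$ weakly-$*$ as measures on $\mathbb T^n$ (that is, tested against all continuous functions), where $0\le g\in L^1(\mathbb T^n)$ and $\mu^s$ is a finite positive Borel measure singular with respect to Lebesgue measure. Let $v\in\mathbb R^n$ with $|v|=1$, and suppose that for some subsequence $(k_j)_j$ the measures $|(Du_{k_j},v)|^p\,dx$ converge weakly-$*$ to a finite positive Borel measure $\gamma$ that is diffuse, i.e. $\gamma(\{x\})=0$ for every $x\in\mathbb T^n$. Then: 1. $\mu^s=0$; 2. if, moreover, $u_k\rightharpoonup u$ weakly in $L^{p^*}(\mathbb T^n)$ and $u_k\to u$ strongly in $L^1(\mathbb T^n)$ for some $u\in L^{p^*}(\mathbb T^n)$, then $u_k\to u$ strongly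 in $L^{p^*}(\mathbb T^n)$. -/

import Mathlib

open MeasureTheory Filter Topology
open scoped ENNReal NNReal ContDiff

noncomputable section

/-- The flat torus `ℝⁿ / ℤⁿ`; its `volume` is Lebesgue measure, of total mass one. -/
abbrev Torus (n : ℕ) : Type := UnitAddTorus (Fin n)

/-- The quotient map `ℝⁿ → ℝⁿ / ℤⁿ`. -/
def Torus.mk {n : ℕ} (x : EuclideanSpace ℝ (Fin n)) : Torus n := fun i => (x i : UnitAddCircle)

/-- `φ` is smooth on the torus, i.e. its periodic lift to `ℝⁿ` is smooth. -/
def Torus.IsSmooth {n : ℕ} (φ : Torus n → ℝ) : Prop :=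
  ContDiff ℝ ∞ (fun x : EuclideanSpace ℝ (Fin n) => φ (Torus.mk x))

/-- The classical `i`-th partial derivative of a function on the torus. -/
def Torus.partialDeriv {n : ℕ} (i : Fin n) (φ : Torus n → ℝ) (t : Torus n) : ℝ :=
  deriv (fun s : ℝ => φ (t + Torus.mk (EuclideanSpace.single i s))) 0

/-- `G` is the weak (distributional) gradient of `u` on the torus. It is meant for integrable
`u` and `G`. -/
def Torus.IsWeakGradient {n : ℕ} (u : Torus n → ℝ) (G : Torus n → EuclideanSpace ℝ (Fin n)) :
    Prop :=
  ∀ φ : Torus n → ℝ, Torus.IsSmooth φ → ∀ i : Fin n,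
    ∫ x, u x * Torus.partialDeriv i φ x = -∫ x, G x i * φ x

/-- `u` belongs to `W^{1,p}` of the torus and `G` is (a representative of) its gradient `Du`. -/
structure Torus.MemSobolev {n : ℕ} (p : ℝ≥0∞) (u : Torus n → ℝ)
    (G : Torus n → EuclideanSpace ℝ (Fin n)) : Prop where
  memLp : MemLp u p volume
  memLp_grad : MemLp G p volume
  isWeakGradient : Torus.IsWeakGradient u G

/-- The `W^{1,p}` norm `‖u‖_{L^p} + ‖Du‖_{L^p}`, where `G = Du`. -/
def Torus.sobolevNorm {n : ℕ} (p : ℝ≥0∞) (u : Torus n → ℝ)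
    (G : Torus n → EuclideanSpace ℝ (Fin n)) : ℝ≥0∞ :=
  eLpNorm u p volume + eLpNorm G p volume

/-- The Sobolev exponent `p^* = n p / (n - p)`, for `p < n`. -/
def sobolevExponent (n : ℕ) (p : ℝ) : ℝ := n * p / (n - p)

/-- The measure `f dx` on the torus, for a nonnegative function `f`. -/
def Torus.density {n : ℕ} (f : Torus n → ℝ) : Measure (Torus n) :=
  volume.withDensity (fun x => ENNReal.ofReal (f x))

/-- Weak-star convergence of positive finite measures on the torus: convergence of the integrals
of all continuous functions. -/
def Torus.WeakStarTendsto {n : ℕ} (ν : ℕ → Measure (Torus n)) (μ : Measure (Torus n)) : Prop :=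
  ∀ φ : C(Torus n, ℝ), Tendsto (fun k => ∫ x, φ x ∂(ν k)) atTop (𝓝 (∫ x, φ x ∂μ))

/-- A measure is diffuse if it does not charge points. -/
def Torus.IsDiffuse {n : ℕ} (γ : Measure (Torus n)) : Prop := ∀ x : Torus n, γ {x} = 0

/-- Strong convergence in `L^r` of the torus. -/
structure Torus.StrongLpTendsto {n : ℕ} (r : ℝ≥0∞) (w : ℕ → Torus n → ℝ) (u : Torus n → ℝ) :
    Prop where
  memLp : ∀ k, MemLp (w k) r volume
  memLp_limit : MemLp u r volume
  tendsto : Tendsto (fun k => eLpNorm (w k - u) r volume) atTop (𝓝 0)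

/-- Weak convergence in `L^r` of the torus for `1 ≤ r < ∞`, tested against `L^{r'}` with
`1/r + 1/r' = 1`. -/
structure Torus.WeakLpTendsto {n : ℕ} (r : ℝ≥0∞) (w : ℕ → Torus n → ℝ) (u : Torus n → ℝ) :
    Prop where
  memLp : ∀ k, MemLp (w k) r volume
  memLp_limit : MemLp u r volume
  tendsto : ∀ r' : ℝ≥0∞, r.HolderConjugate r' → ∀ ψ : Torus n → ℝ, MemLp ψ r' volume →
    Tendsto (fun k => ∫ x, w k x * ψ x) atTop (𝓝 (∫ x, u x * ψ x))

end

noncomputable section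

/-! ### The torus as a quotient of `ℝⁿ`, and `C¹` functions on it. -/

namespace Torus

variable {n : ℕ}

/-! Control of a single directional derivative already excludes concentration. Applying the Sobolev
inequality on `ℝⁿ` to `H ∘ A`, with `A` the dilation by `l` along `v`, gives `‖H‖_q ≤ C l^(-1/n)
(‖DH‖_p + l ‖D_v H‖_p)` with `q = p*`. For large `l` the full gradient has a coefficient as small as
desired, at the price of a large coefficient of `D_v H` (`eLpNorm_le_dilated_sobolev`; on the torus,
`eLpNorm_le_directional_sobolev`).

This is localized with bumps of radius `r` centred at `y` and raised to the power `q`. Since `q >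
p`, a factor with exponent `q - p` can be split off each local norm and bounded uniformly in `y`;
the remaining `p`-th powers, integrated over `y`, add up to a multiple of `‖Df‖_p^p`. Hence `‖f‖_q`
is small once `D_v f` is small in `L^p` on every ball of radius comparable to `r` and `‖f‖_p` is
small enough (`exists_eLpNorm_le_of_localized`). The smallness required of `D_v f` does not depend
on `r`.

Diffuseness of `γ` and compactness of the torus provide such an `r` (`IsDiffuse.exists_radius`), and
Rellich compactness makes differences of a further subsequence small in `L^p`. So that subsequence
is Cauchy in `L^q` and converges strongly to some `U` (`exists_subseq_tendsto_sobolevExponent`).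
Therefore `g dx + μ^s = |U|^q dx`, which is absolutely continuous, and `μ^s = 0`.

For the second claim, `U` equals the `L¹` limit. Testing the weak-star convergence with the constant
`1` gives convergence of the `L^q` norms of the whole sequence, and together with convergence in
measure this gives strong convergence. -/

instance : IsProbabilityMeasure (volume : Measure (Torus n)) :=
  have : IsProbabilityMeasure (volume : Measure UnitAddCircle) := ⟨UnitAddCircle.measure_univ⟩
  inferInstanceAs (IsProbabilityMeasure (Measure.pi fun _ : Fin n => volume))

instance : (volume : Measure (Torus n)).IsNegInvariant :=
  Measure.IsAddHaarMeasure.isNegInvariant_of_regular volume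

theorem mk_add (x y : EuclideanSpace ℝ (Fin n)) : mk (x + y) = mk x + mk y := by
  ext i; simp [mk]

theorem mk_sub (x y : EuclideanSpace ℝ (Fin n)) : mk (x - y) = mk x - mk y := by
  ext i; simp [mk]

@[simp] theorem mk_zero : mk (0 : EuclideanSpace ℝ (Fin n)) = 0 := by
  ext i; simp [mk]

theorem isOpenQuotientMap_mk : IsOpenQuotientMap (mk (n := n)) := by
  have h : IsOpenQuotientMap (Pi.map (fun (_ : Fin n) (s : ℝ) => (s : UnitAddCircle))) :=
    IsOpenQuotientMap.piMap fun _ => QuotientAddGroup.isOpenQuotientMap_mk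
  exact h.comp (PiLp.homeomorph 2 (fun _ : Fin n => ℝ)).isOpenQuotientMap

theorem continuous_mk : Continuous (mk (n := n)) := isOpenQuotientMap_mk.continuous

theorem surjective_mk : Function.Surjective (mk (n := n)) := isOpenQuotientMap_mk.surjective

/-- Every point of the torus has a lift whose coordinates are bounded by its norm. -/
theorem exists_mk_eq_norm_le (t : Torus n) :
    ∃ h : EuclideanSpace ℝ (Fin n), mk h = t ∧ ‖h‖ ≤ √n * ‖t‖ := by
  have key : ∀ s : UnitAddCircle, ∃ x : ℝ, (x : UnitAddCircle) = s ∧ |x| = ‖s‖ := by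
    intro s
    obtain ⟨x, hx⟩ := QuotientAddGroup.mk_surjective s
    refine ⟨x - round x, ?_, ?_⟩
    · rw [← hx]
      have : ((round x : ℝ) : UnitAddCircle) = 0 := by
        rw [AddCircle.coe_eq_zero_iff]; exact ⟨round x, by simp⟩
      change ((x - round x : ℝ) : UnitAddCircle) = (x : UnitAddCircle)
      rw [AddCircle.coe_sub, this, sub_zero]
    · rw [← hx]; exact (UnitAddCircle.norm_eq (x := x)).symm
  choose g hg hg' using key
  refine ⟨WithLp.toLp 2 fun i => g (t i), ?_, ?_⟩
  · ext i; exact hg (t i)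
  -- The norm on the torus is the maximum of the coordinate norms, hence the factor `√n` against the
  -- Euclidean norm.
  · rw [EuclideanSpace.norm_eq]
    refine Real.sqrt_le_iff.2 ⟨by positivity, ?_⟩
    calc ∑ i, ‖g (t i)‖ ^ 2 ≤ ∑ _i : Fin n, ‖t‖ ^ 2 := by
          refine Finset.sum_le_sum fun i _ => ?_
          rw [Real.norm_eq_abs, hg']
          gcongr
          exact norm_le_pi_norm t i
      _ = (√n * ‖t‖) ^ 2 := by
          rw [mul_pow, Real.sq_sqrt (Nat.cast_nonneg n)]; simp

/-- The half-open unit cube with lower corner `a`. -/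
def cube (a : Fin n → ℝ) : Set (EuclideanSpace ℝ (Fin n)) :=
  {x | ∀ i, x i ∈ Set.Ioc (a i) (a i + 1)}

theorem measurableSet_cube (a : Fin n → ℝ) : MeasurableSet (cube a) := by
  have : cube a = ⋂ i, (fun x : EuclideanSpace ℝ (Fin n) => x i) ⁻¹' Set.Ioc (a i) (a i + 1) := by
    ext x; simp [cube]
  rw [this]
  exact MeasurableSet.iInter fun i =>
    (EuclideanSpace.proj i : EuclideanSpace ℝ (Fin n) →L[ℝ] ℝ).continuous.measurable measurableSet_Ioc

/-- A half-open unit cube is a fundamental domain: the statement is the product of its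
one-dimensional versions. The corner is arbitrary because bounded sets are later covered by integer
translates. -/
theorem measurePreserving_mk (a : Fin n → ℝ) :
    MeasurePreserving (mk (n := n)) (volume.restrict (cube a)) volume := by
  have h1 := measurePreserving_pi _ _ (fun i : Fin n => UnitAddCircle.measurePreserving_mk (a i))
  rw [← Measure.restrict_pi_pi] at h1
  have h2 := (PiLp.volume_preserving_ofLp (Fin n)).restrict_preimage
    (s := Set.univ.pi fun i => Set.Ioc (a i) (a i + 1))
    (MeasurableSet.univ_pi fun i => measurableSet_Ioc)
  have h3 := h1.comp h2
  have h4 : (WithLp.ofLp ⁻¹' Set.univ.pi fun i => Set.Ioc (a i) (a i + 1)) = cube a := by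
    ext x; simp [cube]
  rw [h4] at h3
  exact h3

/-- `f` is continuously differentiable on the torus with gradient `f'`. -/
structure HasC1Deriv (f : Torus n → ℝ) (f' : Torus n → EuclideanSpace ℝ (Fin n)) : Prop where
  intro ::
  continuous_deriv : Continuous f'
  hasFDerivAt : ∀ x, HasFDerivAt (fun x => f (mk x)) (innerSL ℝ (f' (mk x))) x

variable {f g : Torus n → ℝ} {f' g' : Torus n → EuclideanSpace ℝ (Fin n)}

theorem HasC1Deriv.continuous_lift (hf : HasC1Deriv f f') : Continuous fun x => f (mk x) :=
  continuous_iff_continuousAt.2 fun x => (hf.hasFDerivAt x).continuousAt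

theorem HasC1Deriv.continuous (hf : HasC1Deriv f f') : Continuous f :=
  isOpenQuotientMap_mk.isQuotientMap.continuous_iff.2 hf.continuous_lift

theorem HasC1Deriv.fderiv_lift (hf : HasC1Deriv f f') :
    fderiv ℝ (fun x => f (mk x)) = fun x => innerSL ℝ (f' (mk x)) :=
  funext fun x => (hf.hasFDerivAt x).fderiv

theorem HasC1Deriv.contDiff_lift (hf : HasC1Deriv f f') : ContDiff ℝ 1 fun x => f (mk x) := by
  rw [contDiff_one_iff_fderiv]
  refine ⟨fun x => (hf.hasFDerivAt x).differentiableAt, ?_⟩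
  rw [hf.fderiv_lift]
  exact (innerSL ℝ).continuous.comp (hf.continuous_deriv.comp continuous_mk)

theorem HasC1Deriv.mul (hf : HasC1Deriv f f') (hg : HasC1Deriv g g') :
    HasC1Deriv (fun t => f t * g t) (fun t => f t • g' t + g t • f' t) where
  continuous_deriv := (hf.continuous.smul hg.continuous_deriv).add
    (hg.continuous.smul hf.continuous_deriv)
  hasFDerivAt x := by
    refine ((hf.hasFDerivAt x).mul (hg.hasFDerivAt x)).congr_fderiv ?_
    simp

theorem HasC1Deriv.comp_sub_const (hf : HasC1Deriv f f') (y : Torus n) :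
    HasC1Deriv (fun t => f (t - y)) (fun t => f' (t - y)) where
  continuous_deriv := hf.continuous_deriv.comp (continuous_id.sub continuous_const)
  hasFDerivAt x := by
    obtain ⟨y, rfl⟩ := surjective_mk y
    simp_rw [← mk_sub]
    exact ((hf.hasFDerivAt (x - y)).comp x ((hasFDerivAt_id x).sub_const y)).congr_fderiv
      (ContinuousLinearMap.comp_id _)

theorem HasC1Deriv.comp_const_sub (hf : HasC1Deriv f f') (y : Torus n) :
    HasC1Deriv (fun t => f (y - t)) (fun t => -f' (y - t)) where
  continuous_deriv := (hf.continuous_deriv.comp (continuous_sub_left y)).neg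
  hasFDerivAt x := by
    obtain ⟨y, rfl⟩ := surjective_mk y
    simp_rw [← mk_sub]
    exact ((hf.hasFDerivAt (y - x)).comp x ((hasFDerivAt_id x).const_sub y)).congr_fderiv
      (by ext; simp)

theorem HasC1Deriv.partialDeriv_eq (hf : HasC1Deriv f f') (i : Fin n) (t : Torus n) :
    partialDeriv i f t = f' t i := by
  obtain ⟨x, rfl⟩ := surjective_mk t
  have e1 : HasDerivAt (fun s : ℝ => x + EuclideanSpace.single i s)
      (EuclideanSpace.single i (1 : ℝ)) 0 := by
    have h := ((hasDerivAt_id (0 : ℝ)).smul_const (EuclideanSpace.single i (1 : ℝ))).const_add x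
    rw [one_smul] at h
    refine h.congr_of_eventuallyEq (.of_forall fun s => ?_)
    ext j
    by_cases hj : j = i <;> simp [hj]
  have e2 := (hf.hasFDerivAt x).comp_hasDerivAt_of_eq (0 : ℝ) e1 (by simp)
  simp_rw [partialDeriv, ← mk_add]
  rw [Function.comp_def] at e2
  rw [e2.deriv]
  simp [EuclideanSpace.inner_single_right]

/-- A smooth function on the torus is continuously differentiable. -/
theorem IsSmooth.exists_hasC1Deriv {φ : Torus n → ℝ} (hφ : IsSmooth φ) :
    ∃ φ', HasC1Deriv φ φ' := by
  have hd : Differentiable ℝ fun x => φ (mk x) := hφ.differentiable (by simp)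
  let D : EuclideanSpace ℝ (Fin n) → EuclideanSpace ℝ (Fin n) := fun x =>
    (InnerProductSpace.toDual ℝ _).symm (fderiv ℝ (fun x => φ (mk x)) x)
  -- The lift of `φ` is invariant under translation by the difference of two lifts of one point, so
  -- its gradient descends to the torus.
  have hper : ∀ x y, mk x = mk y → D x = D y := by
    intro x y hxy
    have : (fun z => φ (mk z)) = fun z => φ (mk (z + (x - y))) := by
      funext z
      rw [mk_add, mk_sub, hxy, sub_self, add_zero]
    simp only [D]
    congr 1
    conv_rhs => rw [this]
    rw [fderiv_comp_add_right (f := fun z => φ (mk z)) (x - y)]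
    simp
  let φ' : Torus n → EuclideanSpace ℝ (Fin n) := fun t => D (Function.surjInv surjective_mk t)
  have hφ' : ∀ x, φ' (mk x) = D x := fun x => hper _ _ (Function.surjInv_eq surjective_mk _)
  refine ⟨φ', ?_, fun x => ?_⟩
  · refine isOpenQuotientMap_mk.isQuotientMap.continuous_iff.2 ?_
    have : φ' ∘ mk = D := funext hφ'
    rw [this]
    exact (InnerProductSpace.toDual ℝ _).symm.continuous.comp
      (hφ.continuous_fderiv (by simp))
  · rw [hφ']
    refine (hd x).hasFDerivAt.congr_fderiv ?_
    ext z
    simp [D]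

end Torus

/-! ### Anisotropic Sobolev inequalities. -/

/-- The Sobolev inequality after dilating by `l` in the direction `v`. -/
theorem eLpNorm_le_dilated_sobolev {n : ℕ} (hn : 0 < n) {p q : ℝ≥0} (hp : 1 ≤ p) (hq : 0 < q)
    (hpq : (q : ℝ)⁻¹ = (p : ℝ)⁻¹ - (n : ℝ)⁻¹) (v : EuclideanSpace ℝ (Fin n)) (hv : ‖v‖ = 1) :
    ∃ C : ℝ≥0, ∀ l : ℝ, 1 ≤ l → ∀ H : EuclideanSpace ℝ (Fin n) → ℝ, ContDiff ℝ 1 H →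
      HasCompactSupport H →
      eLpNorm H q volume ≤ C * ENNReal.ofReal (l⁻¹) ^ ((n : ℝ)⁻¹) *
        (eLpNorm (fderiv ℝ H) p volume +
          ENNReal.ofReal l * eLpNorm (fun x => fderiv ℝ H x v) p volume) := by
  refine ⟨SNormLESNormFDerivOfEqConst ℝ (volume : Measure (EuclideanSpace ℝ (Fin n))) p,
    fun l hl H hH hHc => ?_⟩
  set C := SNormLESNormFDerivOfEqConst ℝ (volume : Measure (EuclideanSpace ℝ (Fin n))) p
  have hl0 : 0 < l := by linarith
  have hp0 : (p : ℝ≥0∞) ≠ 0 := by exact_mod_cast (zero_lt_one.trans_le hp).ne'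
  have hq0 : (q : ℝ≥0∞) ≠ 0 := by exact_mod_cast hq.ne'
  -- `A = I + (l - 1) v ⊗ v` stretches by `l` along `v` and fixes the orthogonal complement, so its
  -- determinant is `l`.
  let A : EuclideanSpace ℝ (Fin n) →ₗ[ℝ] EuclideanSpace ℝ (Fin n) :=
    LinearMap.transvection ((l - 1) • (innerSL ℝ v).toLinearMap) v
  have hA : ∀ x, A x = x + ((l - 1) * inner ℝ v x) • v := fun x => by
    simp [A, LinearMap.transvection.apply]
  have hdet : LinearMap.det A = l := by
    simp [A, hv]
  have hdet0 : LinearMap.det A ≠ 0 := by rw [hdet]; exact hl0.ne'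
  let Ae := (LinearMap.equivOfDetNeZero A hdet0).toContinuousLinearEquiv
  have hAe : ∀ x, Ae x = A x := fun x => rfl
  have hmeas : Measurable (fun x => A x) := (Ae.continuous.measurable : Measurable Ae)
  set c : ℝ≥0∞ := ENNReal.ofReal l⁻¹ with hc
  have hc0 : c ≠ 0 := by simp [hc, hl0]
  have hct : c ≠ ⊤ := ENNReal.ofReal_ne_top
  have hmap : Measure.map (fun x => A x) (volume : Measure (EuclideanSpace ℝ (Fin n))) =
      c • volume := by
    have := Measure.map_linearMap_addHaar_eq_smul_addHaar
      (volume : Measure (EuclideanSpace ℝ (Fin n))) hdet0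
    rw [hdet, abs_of_pos (inv_pos.2 hl0)] at this
    exact this
  have hscale : ∀ {F : Type} [NormedAddCommGroup F] (r : ℝ≥0)
      (h : EuclideanSpace ℝ (Fin n) → F), Continuous h →
      eLpNorm (fun x => h (A x)) r volume = c ^ ((r : ℝ)⁻¹) * eLpNorm h r volume := by
    intro F _ r h hh
    have h1 := eLpNorm_map_measure (μ := (volume : Measure (EuclideanSpace ℝ (Fin n))))
      (p := (r : ℝ≥0∞)) (f := fun x => A x) (g := h) hh.aestronglyMeasurable hmeas.aemeasurable
    rw [hmap, eLpNorm_smul_measure_of_ne_top ENNReal.coe_ne_top] at h1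
    rw [Function.comp_def] at h1
    rw [← h1]
    simp
  have hHA : ContDiff ℝ 1 fun x => H (A x) := hH.comp (Ae.contDiff : ContDiff ℝ 1 Ae)
  have hHAc : HasCompactSupport fun x => H (A x) :=
    hHc.comp_homeomorph Ae.toHomeomorph
  have hsob := eLpNorm_le_eLpNorm_fderiv_of_eq (μ := volume) hHA hHAc hp
    (by simpa using hn) (p' := q) (by simpa using hpq)
  have hfd : ∀ x, fderiv ℝ (fun x => H (A x)) x =
      (fderiv ℝ H (A x)).comp (Ae : EuclideanSpace ℝ (Fin n) →L[ℝ] _) := by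
    intro x
    exact (((hH.differentiable (by simp)) (A x)).hasFDerivAt.comp x Ae.hasFDerivAt).fderiv
  have hcd : Continuous (fderiv ℝ H) := hH.continuous_fderiv (by simp)
  have hcdv : Continuous fun x => fderiv ℝ H x v := hcd.clm_apply continuous_const
  have hbound : ∀ x, ‖fderiv ℝ (fun x => H (A x)) x‖ ≤
      ‖fderiv ℝ H (A x)‖ + l * ‖fderiv ℝ H (A x) v‖ := by
    intro x
    refine ContinuousLinearMap.opNorm_le_bound _ (by positivity) fun z => ?_
    rw [hfd]
    simp only [ContinuousLinearMap.comp_apply, ContinuousLinearEquiv.coe_coe, hAe, hA z, map_add,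
      map_smul]
    refine (norm_add_le _ _).trans ?_
    rw [add_mul, norm_smul]
    refine add_le_add (ContinuousLinearMap.le_opNorm _ _) ?_
    have h2 : ‖(l - 1) * inner ℝ v z‖ ≤ l * ‖z‖ := by
      rw [norm_mul, Real.norm_of_nonneg (by linarith)]
      have := norm_inner_le_norm (𝕜 := ℝ) v z
      rw [hv, one_mul] at this
      nlinarith [norm_nonneg (inner ℝ v z), norm_nonneg z]
    calc _ ≤ (l * ‖z‖) * ‖fderiv ℝ H (A x) v‖ := by gcongr
      _ = _ := by ring
  have hstep : eLpNorm (fderiv ℝ fun x => H (A x)) p volume ≤ c ^ ((p : ℝ)⁻¹) *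
      (eLpNorm (fderiv ℝ H) p volume +
          ENNReal.ofReal l * eLpNorm (fun x => fderiv ℝ H x v) p volume) := by
    let G : EuclideanSpace ℝ (Fin n) → ℝ := fun y => ‖fderiv ℝ H y‖ + l * ‖fderiv ℝ H y v‖
    have hG : Continuous G := hcd.norm.add (continuous_const.mul hcdv.norm)
    calc eLpNorm (fderiv ℝ fun x => H (A x)) p volume
        ≤ eLpNorm (fun x => G (A x)) p volume := eLpNorm_mono_real hbound
      _ = c ^ ((p : ℝ)⁻¹) * eLpNorm G p volume := hscale p G hG
      _ ≤ _ := by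
        gcongr
        refine (eLpNorm_add_le hcd.norm.aestronglyMeasurable
          (continuous_const.mul hcdv.norm).aestronglyMeasurable (by exact_mod_cast hp)).trans ?_
        rw [eLpNorm_norm]
        gcongr
        have := eLpNorm_const_smul (c := l) (f := fun y => ‖fderiv ℝ H y v‖) (p := (p : ℝ≥0∞))
          (μ := volume)
        rw [eLpNorm_norm, Real.enorm_eq_ofReal hl0.le] at this
        exact this.le
  rw [hscale q H hH.continuous] at hsob
  -- The change of variables puts `c^(1/q)` on the left and `c^(1/p)` on the right, with `c = 1/l`;
  -- the surplus `c^(1/n)` is the gain.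
  have hexp : (p : ℝ)⁻¹ = (q : ℝ)⁻¹ + (n : ℝ)⁻¹ := by rw [hpq]; ring
  have hcq0 : c ^ ((q : ℝ)⁻¹) ≠ 0 := by simp [ENNReal.rpow_eq_zero_iff, hc0, hct]
  have hcqt : c ^ ((q : ℝ)⁻¹) ≠ ⊤ := ENNReal.rpow_ne_top_of_nonneg (by positivity) hct
  rw [← ENNReal.mul_le_mul_iff_right hcq0 hcqt]
  refine hsob.trans ((mul_le_mul_right hstep _).trans (le_of_eq ?_))
  rw [hexp, ENNReal.rpow_add _ _ hc0 hct]
  ring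

namespace Torus

variable {n : ℕ}

/-- A bounded set covers the torus finitely many times. -/
theorem exists_map_restrict_mk_le (S : Set (EuclideanSpace ℝ (Fin n))) (hS : Bornology.IsBounded S) :
    ∃ N : ℝ≥0, Measure.map mk (volume.restrict S) ≤ N • (volume : Measure (Torus n)) := by
  obtain ⟨R, hR⟩ := hS.exists_norm_le
  let I : Finset (Fin n → ℤ) := Fintype.piFinset fun _ => Finset.Icc (-⌈R⌉ - 1) ⌈R⌉
  refine ⟨I.card, Measure.le_iff.2 fun B hB => ?_⟩
  have hcov : S ⊆ ⋃ a ∈ I, cube (n := n) (fun i => (a i : ℝ)) := by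
    intro x hx
    have hi : ∀ i, |x i| ≤ R := fun i => (PiLp.norm_apply_le x i).trans (hR x hx)
    -- The cubes are open at their lower faces, so the corner is `⌈x i⌉ - 1` and not the floor; this
    -- also explains the lower bound `-⌈R⌉ - 1` in `I`.
    refine Set.mem_biUnion (x := fun i => ⌈x i⌉ - 1) ?_ ?_
    · rw [Finset.mem_coe, Fintype.mem_piFinset]
      intro i
      rw [Finset.mem_Icc]
      have h1 := abs_le.1 (hi i)
      constructor
      · have : -⌈R⌉ ≤ ⌈x i⌉ := by
          have : (-⌈R⌉ : ℤ) = ⌊-R⌋ := (Int.floor_neg).symm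
          rw [this]
          exact (Int.floor_mono h1.1).trans (Int.floor_le_ceil _)
        omega
      · have : ⌈x i⌉ ≤ ⌈R⌉ := Int.ceil_mono h1.2
        omega
    · intro i
      have h1 := Int.ceil_lt_add_one (x i)
      have h2 := Int.le_ceil (x i)
      simp only [Int.cast_sub, Int.cast_one, Set.mem_Ioc]
      constructor <;> linarith
  rw [Measure.map_apply continuous_mk.measurable hB,
    Measure.restrict_apply (continuous_mk.measurable hB)]
  calc volume (mk ⁻¹' B ∩ S) ≤ volume (⋃ a ∈ I, mk ⁻¹' B ∩ cube (fun i => (a i : ℝ))) := by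
        rw [← Set.inter_iUnion₂]
        exact measure_mono (Set.inter_subset_inter_right _ hcov)
    _ ≤ ∑ a ∈ I, volume (mk ⁻¹' B ∩ cube (fun i => (a i : ℝ))) := measure_biUnion_finset_le _ _
    _ = ∑ _a ∈ I, volume B := by
        refine Finset.sum_congr rfl fun a _ => ?_
        rw [← Measure.restrict_apply (continuous_mk.measurable hB)]
        exact (measurePreserving_mk _).measure_preimage hB.nullMeasurableSet
    _ = _ := by simp [ENNReal.smul_def]

/-- A Sobolev inequality on the torus, in which the coefficient of the full gradient is as small
as desired at the price of a large coefficient of one directional derivative. -/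
theorem eLpNorm_le_directional_sobolev (hn : 0 < n) {p q : ℝ≥0} (hp : 1 ≤ p) (hq : 0 < q)
    (hpq : (q : ℝ)⁻¹ = (p : ℝ)⁻¹ - (n : ℝ)⁻¹) (v : EuclideanSpace ℝ (Fin n)) (hv : ‖v‖ = 1)
    {η : ℝ≥0} (hη : 0 < η) :
    ∃ C : ℝ≥0, ∀ (f : Torus n → ℝ) (f' : Torus n → EuclideanSpace ℝ (Fin n)), HasC1Deriv f f' →
      eLpNorm f q volume ≤ η * eLpNorm f' p volume +
        C * (eLpNorm (fun t => inner ℝ (f' t) v) p volume + eLpNorm f p volume) := by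
  obtain ⟨C, hC⟩ := eLpNorm_le_dilated_sobolev hn hp hq hpq v hv
  have hp0 : (p : ℝ≥0∞) ≠ 0 := by exact_mod_cast (zero_lt_one.trans_le hp).ne'
  have hp1 : (1 : ℝ≥0∞) ≤ p := by exact_mod_cast hp
  -- The unit cube has diameter `√n`, so this cut-off is `1` on a fundamental domain, and the
  -- periodic lift times `Θ` is an admissible function on `ℝⁿ`.
  let Θ : ContDiffBump (0 : EuclideanSpace ℝ (Fin n)) := ⟨√n + 1, √n + 2, by positivity, by simp⟩
  let S : Set (EuclideanSpace ℝ (Fin n)) := Metric.closedBall 0 (√n + 2)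
  obtain ⟨N, hN⟩ := exists_map_restrict_mk_le S Metric.isBounded_closedBall
  have hper : ∀ h : Torus n → ℝ, Continuous h → eLpNorm (fun x => h (mk x)) p (volume.restrict S) ≤
      (N : ℝ≥0∞) ^ ((p : ℝ)⁻¹) * eLpNorm h p volume := by
    intro h hh
    have h1 := eLpNorm_map_measure (μ := volume.restrict S)
      (p := (p : ℝ≥0∞)) (f := mk) (g := h) hh.aestronglyMeasurable continuous_mk.measurable.aemeasurable
    rw [Function.comp_def] at h1
    rw [← h1]
    refine (eLpNorm_mono_measure _ hN).trans ?_
    have := eLpNorm_smul_measure_of_ne_top (p := (p : ℝ≥0∞)) ENNReal.coe_ne_top h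
      (μ := volume) (N : ℝ≥0∞)
    simpa using this.le
  have hΘd : ContDiff ℝ 1 Θ := Θ.contDiff
  obtain ⟨K, hK⟩ := (hΘd.continuous_fderiv (by simp)).bounded_above_of_compact_support
    (Θ.hasCompactSupport.fderiv (𝕜 := ℝ))
  have hK0 : 0 ≤ K := (norm_nonneg _).trans (hK 0)
  lift K to ℝ≥0 using hK0
  set m : ℝ≥0∞ := (N : ℝ≥0∞) ^ ((p : ℝ)⁻¹) with hm
  have hmt : m ≠ ⊤ := ENNReal.rpow_ne_top_of_nonneg (by positivity) ENNReal.coe_ne_top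
  -- The coefficient of the full gradient decays like `l^(-1/n)`; `m` accounts for the overlaps in
  -- the periodic covering.
  obtain ⟨l, hl1, hl⟩ : ∃ l : ℝ, 1 ≤ l ∧ C * ENNReal.ofReal (l⁻¹) ^ ((n : ℝ)⁻¹) * m ≤ η := by
    have h1 : Tendsto (fun l : ℝ => C * ENNReal.ofReal (l⁻¹) ^ ((n : ℝ)⁻¹) * m) atTop (𝓝 0) := by
      have h2 := (ENNReal.continuous_rpow_const (y := (n : ℝ)⁻¹)).continuousAt.tendsto.comp
        (ENNReal.tendsto_ofReal tendsto_inv_atTop_zero)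
      have h3 := ENNReal.Tendsto.mul_const (ENNReal.Tendsto.const_mul h2
        (Or.inr (ENNReal.coe_ne_top (r := C)))) (Or.inr hmt)
      simpa [ENNReal.zero_rpow_of_pos, hn] using h3
    obtain ⟨l, h, h'⟩ := ((eventually_ge_atTop (1 : ℝ)).and
      (h1.eventually (gt_mem_nhds (ENNReal.coe_pos.2 hη)))).exists
    exact ⟨l, h, h'.le⟩
  lift l to ℝ≥0 using by linarith
  refine ⟨η * (K + l + l * K), fun f f' hf => ?_⟩
  let H : EuclideanSpace ℝ (Fin n) → ℝ := fun x => Θ x * f (mk x)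
  have hHC : ContDiff ℝ 1 H := hΘd.mul hf.contDiff_lift
  have hHs : HasCompactSupport H := Θ.hasCompactSupport.mul_right
  have hfd : ∀ x, fderiv ℝ H x = Θ x • innerSL ℝ (f' (mk x)) + f (mk x) • fderiv ℝ Θ x := by
    intro x
    exact ((hΘd.differentiable (by simp) x).hasFDerivAt.mul (hf.hasFDerivAt x)).fderiv
  have hHS : Function.support (fderiv ℝ H) ⊆ S := by
    refine (support_fderiv_subset ℝ).trans ?_
    exact (tsupport_mul_subset_left).trans (by rw [Θ.tsupport_eq])
  have hcf := hf.continuous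
  have hcf' := hf.continuous_deriv
  have hcfv : Continuous fun t => inner ℝ (f' t) v := hcf'.inner continuous_const
  have hest : ∀ (a : Torus n → ℝ), Continuous a →
      eLpNorm (fun t => ‖a t‖ + K * ‖f t‖) p volume ≤
        eLpNorm a p volume + K * eLpNorm f p volume := by
    intro a ha
    refine (eLpNorm_add_le ha.norm.aestronglyMeasurable
      (continuous_const.mul hcf.norm).aestronglyMeasurable hp1).trans ?_
    rw [eLpNorm_norm]
    gcongr
    have := eLpNorm_const_smul (c := (K : ℝ)) (f := fun y => ‖f y‖) (p := (p : ℝ≥0∞))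
      (μ := volume)
    rw [eLpNorm_norm, Real.enorm_eq_ofReal K.coe_nonneg, ENNReal.ofReal_coe_nnreal] at this
    exact this.le
  have hb1 : eLpNorm (fderiv ℝ H) p volume ≤ m * (eLpNorm f' p volume + K * eLpNorm f p volume) := by
    rw [← eLpNorm_restrict_eq_of_support_subset (f := fderiv ℝ H) hHS]
    have h1 := hest (fun t => ‖f' t‖) hcf'.norm
    simp only [norm_norm, eLpNorm_norm] at h1
    refine (eLpNorm_mono_real (g := fun x => ‖f' (mk x)‖ + K * ‖f (mk x)‖) fun x => ?_).trans
      ((hper (fun t => ‖f' t‖ + K * ‖f t‖)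
        (hcf'.norm.add (continuous_const.mul hcf.norm))).trans (mul_le_mul_right h1 m))
    rw [hfd]
    refine (norm_add_le _ _).trans ?_
    rw [norm_smul, norm_smul, innerSL_apply_norm, Real.norm_of_nonneg Θ.nonneg, mul_comm (K : ℝ)]
    exact add_le_add (mul_le_of_le_one_left (norm_nonneg _) Θ.le_one)
      (mul_le_mul_of_nonneg_left (hK x) (norm_nonneg _))
  have hb2 : eLpNorm (fun x => fderiv ℝ H x v) p volume ≤
      m * (eLpNorm (fun t => inner ℝ (f' t) v) p volume + K * eLpNorm f p volume) := by
    have hsup : Function.support (fun x => fderiv ℝ H x v) ⊆ S := by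
      refine Set.Subset.trans (fun x hx => ?_) hHS
      intro h0
      exact hx (by simp [h0])
    rw [← eLpNorm_restrict_eq_of_support_subset hsup]
    have h1 := hest (fun t => inner ℝ (f' t) v) hcfv
    refine (eLpNorm_mono_real (g := fun x => ‖inner ℝ (f' (mk x)) v‖ + K * ‖f (mk x)‖)
      fun x => ?_).trans ((hper (fun t => ‖inner ℝ (f' t) v‖ + K * ‖f t‖)
        (hcfv.norm.add (continuous_const.mul hcf.norm))).trans (mul_le_mul_right h1 m))
    rw [hfd]
    simp only [add_apply, smul_apply, innerSL_apply_apply]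
    refine (norm_add_le _ _).trans ?_
    rw [norm_smul, norm_smul, Real.norm_of_nonneg Θ.nonneg, mul_comm (K : ℝ)]
    refine add_le_add (mul_le_of_le_one_left (norm_nonneg _) Θ.le_one)
      (mul_le_mul_of_nonneg_left ?_ (norm_nonneg _))
    refine (ContinuousLinearMap.le_opNorm _ _).trans ?_
    rw [hv, mul_one]
    exact hK x
  have hfH : eLpNorm f q volume ≤ eLpNorm H q volume := by
    have hmp := measurePreserving_mk (n := n) (fun _ => 0)
    rw [← eLpNorm_comp_measurePreserving hcf.aestronglyMeasurable hmp]
    refine (eLpNorm_congr_ae ?_).trans_le (eLpNorm_restrict_le H q volume (cube fun _ => 0))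
    filter_upwards [ae_restrict_mem (measurableSet_cube _)] with x hx
    have : Θ x = 1 := by
      refine Θ.one_of_mem_closedBall ?_
      rw [mem_closedBall_zero_iff, EuclideanSpace.norm_eq]
      have : ∑ i, ‖x i‖ ^ 2 ≤ n := by
        calc ∑ i, ‖x i‖ ^ 2 ≤ ∑ _i : Fin n, (1 : ℝ) := by
              refine Finset.sum_le_sum fun i _ => ?_
              have := hx i
              simp only [zero_add, Set.mem_Ioc] at this
              rw [Real.norm_of_nonneg this.1.le]
              nlinarith [this.1, this.2]
          _ = n := by simp
      exact (Real.sqrt_le_sqrt this).trans (by change √n ≤ √n + 1; linarith)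
    simp [H, this]
  refine hfH.trans ((hC l hl1 H hHC hHs).trans ?_)
  rw [ENNReal.ofReal_coe_nnreal]
  set X := eLpNorm f' p volume
  set Y := eLpNorm (fun t => inner ℝ (f' t) v) p volume
  set Z := eLpNorm f p volume
  set D := C * ENNReal.ofReal ((l : ℝ)⁻¹) ^ ((n : ℝ)⁻¹)
  calc D * (eLpNorm (fderiv ℝ H) p volume + l * eLpNorm (fun x => fderiv ℝ H x v) p volume)
      ≤ D * (m * (X + K * Z) + l * (m * (Y + K * Z))) := by gcongr
    _ = (D * m) * (X + l * Y + (K + l * K) * Z) := by ring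
    _ ≤ η * (X + (K + l + l * K) * Y + (K + l + l * K) * Z) := by
        gcongr
        · exact le_add_right le_add_self
        · exact le_self_add
    _ = _ := by push_cast; ring

/-! ### Smooth bumps and averages over their translates. -/

/-- A bump on the circle: `1` on the ball of radius `r`, `0` off the ball of radius `2 r`. -/
def circleBump (r : ℝ) (s : UnitAddCircle) : ℝ :=
  Real.smoothTransition ((Real.cos (2 * Real.pi * ‖s‖) - Real.cos (2 * Real.pi * (2 * r))) /
    (Real.cos (2 * Real.pi * r) - Real.cos (2 * Real.pi * (2 * r))))

/-- The norm on the circle is not smooth, but cosine is even and periodic, so its cosine lifts to a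
smooth function. This is why `circleBump` is written with cosines. -/
theorem cos_circle_norm (x : ℝ) :
    Real.cos (2 * Real.pi * ‖(x : UnitAddCircle)‖) = Real.cos (2 * Real.pi * x) := by
  rw [UnitAddCircle.norm_eq]
  have : Real.cos (2 * Real.pi * |x - round x|) = Real.cos (2 * Real.pi * (x - round x)) := by
    rw [← Real.cos_abs (2 * Real.pi * (x - round x)), abs_mul,
      abs_of_pos (by positivity : 0 < 2 * Real.pi)]
  rw [this, mul_sub, mul_comm (2 * Real.pi) (round x : ℝ), Real.cos_sub_int_mul_two_pi]

theorem circle_norm_le_half (s : UnitAddCircle) : ‖s‖ ≤ 1 / 2 := by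
  have := AddCircle.norm_le_half_period (1 : ℝ) (x := s) one_ne_zero
  simpa using this

theorem cos_two_pi_sub_pos {r : ℝ} (hr : 0 < r) (hr' : r ≤ 1 / 4) :
    0 < Real.cos (2 * Real.pi * r) - Real.cos (2 * Real.pi * (2 * r)) := by
  have hpi := Real.pi_pos
  refine sub_pos.2 (Real.strictAntiOn_cos ⟨by positivity, by nlinarith⟩
    ⟨by positivity, by nlinarith⟩ (by nlinarith))

theorem circleBump_eq_one {r : ℝ} (hr : 0 < r) (hr' : r ≤ 1 / 4) {s : UnitAddCircle}
    (hs : ‖s‖ ≤ r) : circleBump r s = 1 := by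
  have hpi := Real.pi_pos
  refine Real.smoothTransition.one_of_one_le ?_
  rw [one_le_div (cos_two_pi_sub_pos hr hr')]
  refine sub_le_sub_right (Real.antitoneOn_cos ⟨by positivity, ?_⟩ ⟨by positivity, ?_⟩ ?_) _
  · nlinarith [circle_norm_le_half s]
  · nlinarith
  · gcongr

theorem circleBump_eq_zero {r : ℝ} (hr : 0 < r) (hr' : r ≤ 1 / 4) {s : UnitAddCircle}
    (hs : 2 * r ≤ ‖s‖) : circleBump r s = 0 := by
  have hpi := Real.pi_pos
  refine Real.smoothTransition.zero_of_nonpos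
    (div_nonpos_of_nonpos_of_nonneg ?_ (cos_two_pi_sub_pos hr hr').le)
  refine sub_nonpos.2 (Real.antitoneOn_cos ⟨by positivity, ?_⟩ ⟨by positivity, ?_⟩ ?_)
  · nlinarith
  · nlinarith [circle_norm_le_half s]
  · gcongr

/-- A smooth bump on the torus: `1` on the ball of radius `r`, `0` off the ball of radius `2 r`. -/
def bump (r : ℝ) (t : Torus n) : ℝ := ∏ i, circleBump r (t i)

theorem bump_nonneg (r : ℝ) (t : Torus n) : 0 ≤ bump r t :=
  Finset.prod_nonneg fun _ _ => Real.smoothTransition.nonneg _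

theorem bump_le_one (r : ℝ) (t : Torus n) : bump r t ≤ 1 :=
  Finset.prod_le_one (fun _ _ => Real.smoothTransition.nonneg _)
    fun _ _ => Real.smoothTransition.le_one _

theorem bump_eq_one {r : ℝ} (hr : 0 < r) (hr' : r ≤ 1 / 4) {t : Torus n} (ht : ‖t‖ ≤ r) :
    bump r t = 1 :=
  Finset.prod_eq_one fun i _ => circleBump_eq_one hr hr' ((norm_le_pi_norm t i).trans ht)

theorem bump_eq_zero {r : ℝ} (hr : 0 < r) (hr' : r ≤ 1 / 4) {t : Torus n} (ht : 2 * r ≤ ‖t‖) :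
    bump r t = 0 := by
  by_contra h
  have h1 : ∀ i, ‖t i‖ < 2 * r := fun i => by
    by_contra! h2
    exact h (Finset.prod_eq_zero (Finset.mem_univ i) (circleBump_eq_zero hr hr' h2))
  exact absurd ht (not_le.2 ((pi_norm_lt_iff (by positivity)).2 h1))

theorem isSmooth_bump (r : ℝ) : IsSmooth (bump r : Torus n → ℝ) := by
  unfold IsSmooth bump circleBump
  refine contDiff_prod fun i _ => Real.smoothTransition.contDiff.comp ?_
  have : (fun x : EuclideanSpace ℝ (Fin n) => Real.cos (2 * Real.pi * ‖mk x i‖)) =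
      fun x => Real.cos (2 * Real.pi * x i) := funext fun x => cos_circle_norm (x i)
  refine ContDiff.div_const (ContDiff.sub ?_ contDiff_const) _
  rw [this]
  exact Real.contDiff_cos.comp
    (contDiff_const.mul (EuclideanSpace.proj i : EuclideanSpace ℝ (Fin n) →L[ℝ] ℝ).contDiff)

theorem continuous_bump (r : ℝ) : Continuous (bump r : Torus n → ℝ) :=
  let ⟨_, h⟩ := (isSmooth_bump r).exists_hasC1Deriv
  h.continuous

/-- For the maximum norm a ball is a cube of side `2 r` as long as it does not wrap around. Doubling
a radius `r ≤ 1 / 4` thus multiplies the volume by exactly `2 ^ n`, whatever `r` is. -/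
theorem volume_closedBall (t : Torus n) {r : ℝ} (hr : 0 ≤ r) (hr' : r ≤ 1 / 2) :
    volume (Metric.closedBall t r) = ENNReal.ofReal (2 * r) ^ n := by
  rw [MeasureTheory.volume_pi_closedBall t hr]
  have : ∀ i, volume (Metric.closedBall (t i) r) = ENNReal.ofReal (2 * r) := fun i => by
    rw [AddCircle.volume_closedBall, min_eq_right (by linarith)]
  simp [this]

/-- Averaging the translates of a weight. -/
theorem lintegral_lintegral_translate_mul {b h : Torus n → ℝ≥0∞} (hb : Measurable b)
    (hh : Measurable h) :
    ∫⁻ y, ∫⁻ x, b (x - y) * h x = (∫⁻ x, b x) * ∫⁻ x, h x := by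
  rw [lintegral_lintegral_swap]
  · have : ∀ x, ∫⁻ y, b (x - y) * h x = (∫⁻ y, b y) * h x := fun x => by
      have hbx : Measurable fun y => b (x - y) := hb.comp (measurable_const.sub measurable_id)
      rw [lintegral_mul_const _ hbx, lintegral_sub_left_eq_self]
    simp_rw [this]
    rw [lintegral_const_mul _ hh]
  · exact ((hb.comp (measurable_snd.sub measurable_fst)).mul (hh.comp measurable_snd)).aemeasurable

/-- With the matching upper bound below, this compares the averaging weights for the exponents `p`
and `q` up to a factor independent of `r`. -/
theorem volume_closedBall_le_lintegral_bump {r s : ℝ} (hr : 0 < r) (hr' : r ≤ 1 / 4) :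
    volume (Metric.closedBall (0 : Torus n) r) ≤ ∫⁻ x : Torus n, ‖bump r x‖ₑ ^ s := by
  rw [← lintegral_indicator_one Metric.isClosed_closedBall.measurableSet]
  refine lintegral_mono fun x => ?_
  by_cases hx : x ∈ Metric.closedBall (0 : Torus n) r
  swap
  · simp [Set.indicator_of_notMem hx]
  rw [Set.indicator_of_mem hx]
  rw [mem_closedBall_zero_iff] at hx
  simp [bump_eq_one hr hr' hx]

theorem lintegral_bump_le_volume_closedBall {r s : ℝ} (hs : 0 < s) (hr : 0 < r)
    (hr' : r ≤ 1 / 4) :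
    ∫⁻ x : Torus n, ‖bump r x‖ₑ ^ s ≤ volume (Metric.closedBall (0 : Torus n) (2 * r)) := by
  rw [← lintegral_indicator_one Metric.isClosed_closedBall.measurableSet]
  refine lintegral_mono fun x => ?_
  by_cases hx : x ∈ Metric.closedBall (0 : Torus n) (2 * r)
  · rw [Set.indicator_of_mem hx]
    refine ENNReal.rpow_le_one ?_ hs.le
    rw [Real.enorm_eq_ofReal (bump_nonneg r x)]
    exact ENNReal.ofReal_le_one.2 (bump_le_one r x)
  · rw [mem_closedBall_zero_iff, not_le] at hx
    simp [bump_eq_zero hr hr' hx.le, hs]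

end Torus

/-! ### The localized inequality for `C¹` functions. -/

theorem ENNReal.exists_pos_mul_rpow_le {A δ : ℝ≥0∞} (hA : A ≠ ⊤) (hδ : 0 < δ) {s : ℝ}
    (hs : 0 < s) : ∃ x : ℝ≥0, 0 < x ∧ A * (x : ℝ≥0∞) ^ s ≤ δ := by
  have h1 : Tendsto (fun x : ℝ≥0∞ => A * x ^ s) (𝓝 0) (𝓝 0) := by
    have h2 := ENNReal.Tendsto.const_mul (a := A)
      (ENNReal.continuous_rpow_const (y := s)).continuousAt.tendsto (Or.inr hA) (m := fun x => x ^ s) (b := 0 ^ s) (f := 𝓝 0)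
    simpa [ENNReal.zero_rpow_of_pos hs] using h2
  have h3 : Tendsto (fun x : ℝ≥0 => (x : ℝ≥0∞)) (𝓝[>] 0) (𝓝 0) :=
    (ENNReal.continuous_coe.tendsto' 0 0 rfl).mono_left nhdsWithin_le_nhds
  obtain ⟨x, hx, hx'⟩ := (((h1.comp h3).eventually (gt_mem_nhds hδ)).and
    self_mem_nhdsWithin).exists
  exact ⟨x, hx', hx.le⟩

theorem ENNReal.add_add_rpow_le {s : ℝ} (hs : 0 ≤ s) (a b c : ℝ≥0∞) :
    (a + b + c) ^ s ≤ 3 ^ s * (a ^ s + b ^ s + c ^ s) := by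
  have h : a + b + c ≤ 3 * max a (max b c) := by
    have h3 : (3 : ℝ≥0∞) = 1 + 1 + 1 := by norm_num
    rw [h3, add_mul, add_mul, one_mul]
    gcongr
    · exact le_max_left _ _
    · exact (le_max_left _ _).trans (le_max_right _ _)
    · exact (le_max_right _ _).trans (le_max_right _ _)
  refine (ENNReal.rpow_le_rpow h hs).trans ?_
  rw [ENNReal.mul_rpow_of_nonneg _ _ hs]
  gcongr
  rcases max_choice a (max b c) with h | h
  · rw [h]; exact (le_self_add).trans le_self_add
  · rw [h]
    rcases max_choice b c with h | h
    · rw [h]; exact le_add_self.trans le_self_add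
    · rw [h]; exact le_add_self

namespace Torus

variable {n : ℕ}

/-- A function with small `L^p` norm, whose derivative in one direction is small on every small
ball, has small norm at the Sobolev exponent. -/
theorem HasC1Deriv.exists_eLpNorm_le_of_localized (hn : 0 < n) {p q : ℝ≥0} (hp : 1 ≤ p)
    (hpq : (q : ℝ)⁻¹ = (p : ℝ)⁻¹ - (n : ℝ)⁻¹) (hplt : p < q) (v : EuclideanSpace ℝ (Fin n))
    (hv : ‖v‖ = 1) (M : ℝ≥0) {ε : ℝ≥0} (hε : 0 < ε) :
    ∃ a : ℝ≥0, 0 < a ∧ ∀ r : ℝ, 0 < r → r ≤ 1 / 4 → ∃ d : ℝ≥0, 0 < d ∧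
      ∀ (f : Torus n → ℝ) (f' : Torus n → EuclideanSpace ℝ (Fin n)), HasC1Deriv f f' →
        eLpNorm f' p volume ≤ M →
        (∀ y, eLpNorm (fun t => bump r (t - y) * inner ℝ (f' t) v) p volume ≤ a) →
        eLpNorm f p volume ≤ d → eLpNorm f q volume ≤ ε := by
  have hp0 : 0 < p := zero_lt_one.trans_le hp
  have hq0 : 0 < q := hp0.trans hplt
  have hP : (0 : ℝ) < p := hp0
  have hQ : (0 : ℝ) < q := hq0
  have hp1 : (1 : ℝ≥0∞) ≤ p := by exact_mod_cast hp
  have hQP : (0 : ℝ) < q - p := sub_pos.2 hplt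
  have hδ : (0 : ℝ≥0∞) < (ε : ℝ≥0∞) ^ (q : ℝ) / 3 :=
    ENNReal.div_pos (ENNReal.rpow_pos (by exact_mod_cast hε) ENNReal.coe_ne_top).ne' (by simp)
  set δ : ℝ≥0∞ := (ε : ℝ≥0∞) ^ (q : ℝ) / 3 with hδdef
  -- The full gradient, the directional derivative and the lower-order terms are each allotted a
  -- third of `ε^q`. The volume ratio `2 ^ n` is free of `r`, so `η`, `C` and `a` are fixed before
  -- `r`; this matters because `r` will be obtained from diffuseness at level `a`.
  obtain ⟨η, hη, hη'⟩ := ENNReal.exists_pos_mul_rpow_le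
    (A := 3 ^ (q : ℝ) * 2 ^ n * ((M : ℝ≥0∞) ^ ((q : ℝ) - p) * (M : ℝ≥0∞) ^ (p : ℝ)))
    (by finiteness) hδ hQ
  obtain ⟨C, hC⟩ := eLpNorm_le_directional_sobolev hn hp hq0 hpq v hv hη
  obtain ⟨a, ha, ha'⟩ := ENNReal.exists_pos_mul_rpow_le
    (A := 3 ^ (q : ℝ) * 2 ^ n * ((C : ℝ≥0∞) ^ (q : ℝ) * (M : ℝ≥0∞) ^ (p : ℝ)))
    (by finiteness) hδ hQP
  refine ⟨a, ha, fun r hr hr' => ?_⟩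
  obtain ⟨β', hβ⟩ := (isSmooth_bump (n := n) r).exists_hasC1Deriv
  obtain ⟨K, hK⟩ : ∃ K : ℝ≥0, ∀ t, ‖β' t‖ ≤ K := by
    obtain ⟨K, hK⟩ := isCompact_univ.exists_bound_of_continuousOn hβ.continuous_deriv.continuousOn
    exact ⟨K.toNNReal, fun t => (hK t trivial).trans (Real.le_coe_toNNReal K)⟩
  set V := volume (Metric.closedBall (0 : Torus n) r) with hV
  have hV' : V = ENNReal.ofReal (2 * r) ^ n := volume_closedBall 0 hr.le (by linarith)
  have hV2 : volume (Metric.closedBall (0 : Torus n) (2 * r)) = 2 ^ n * V := by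
    rw [volume_closedBall 0 (by positivity) (by linarith), hV', ← mul_pow,
      ENNReal.ofReal_mul zero_le_two]
    simp
  have hV0 : V ≠ 0 := by
    rw [hV']; exact pow_ne_zero _ (by simpa using hr)
  have hVt : V ≠ ⊤ := by rw [hV']; finiteness
  set E : ℝ≥0 := η * K + C * (K + 1) with hE
  -- Only `d` depends on `r`, through the gradient bound `K` of the bump and the volume `V`. Here
  -- `E` collects the terms in which the bump is differentiated and the zeroth-order term.
  obtain ⟨d, hd, hd'⟩ := ENNReal.exists_pos_mul_rpow_le
    (A := 3 ^ (q : ℝ) * (E : ℝ≥0∞) ^ (q : ℝ) / V)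
    (ENNReal.div_ne_top (by finiteness) hV0) hδ hQ
  refine ⟨d, hd, fun f f' hf hM hloc hfd => ?_⟩
  set X : Torus n → ℝ≥0∞ := fun y => eLpNorm (fun t => bump r (t - y) • f' t) p volume with hX
  set Y : Torus n → ℝ≥0∞ := fun y =>
    eLpNorm (fun t => bump r (t - y) * inner ℝ (f' t) v) p volume with hY
  set Z : ℝ≥0∞ := eLpNorm f p volume with hZ
  have hcb : ∀ y, Continuous fun t : Torus n => bump r (t - y) := fun y =>
    (continuous_bump r).comp (continuous_id.sub continuous_const)
  have hcf := hf.continuous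
  have hcf' := hf.continuous_deriv
  have hcv : Continuous fun t => inner ℝ (f' t) v := hcf'.inner continuous_const
  have hlow : ∀ y, eLpNorm (fun t => f t • β' (t - y)) p volume ≤ K * Z := by
    intro y
    refine eLpNorm_le_nnreal_smul_eLpNorm_of_ae_le_mul (.of_forall fun t => ?_) _
    rw [nnnorm_smul, mul_comm]
    gcongr
    exact hK _
  have hlowv : ∀ y, eLpNorm (fun t => f t * inner ℝ (β' (t - y)) v) p volume ≤ K * Z := by
    intro y
    refine eLpNorm_le_nnreal_smul_eLpNorm_of_ae_le_mul (.of_forall fun t => ?_) _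
    rw [nnnorm_mul, mul_comm]
    gcongr
    have := norm_inner_le_norm (𝕜 := ℝ) (β' (t - y)) v
    rw [hv, mul_one] at this
    exact this.trans (hK _)
  have hlow0 : ∀ y, eLpNorm (fun t => bump r (t - y) * f t) p volume ≤ Z := by
    intro y
    refine eLpNorm_mono fun t => ?_
    rw [norm_mul, Real.norm_of_nonneg (bump_nonneg _ _)]
    exact mul_le_of_le_one_left (norm_nonneg _) (bump_le_one _ _)
  have hYX : ∀ y, Y y ≤ X y := by
    intro y
    refine eLpNorm_mono fun t => ?_
    rw [norm_mul, norm_smul]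
    gcongr
    simpa [hv] using norm_inner_le_norm (𝕜 := ℝ) (f' t) v
  have hXM : ∀ y, X y ≤ M := by
    intro y
    refine (eLpNorm_mono fun t => ?_).trans hM
    rw [norm_smul, Real.norm_of_nonneg (bump_nonneg _ _)]
    exact mul_le_of_le_one_left (norm_nonneg _) (bump_le_one _ _)
  have hsob : ∀ y, eLpNorm (fun t => bump r (t - y) * f t) q volume ≤
      η * X y + C * Y y + E * Z := by
    intro y
    have hβy := hβ.comp_sub_const y
    have hcβ := hβy.continuous_deriv
    refine (hC _ _ (hβy.mul hf)).trans ?_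
    have h1 : eLpNorm (fun t => bump r (t - y) • f' t + f t • β' (t - y)) p volume ≤
        X y + K * Z :=
      (eLpNorm_add_le ((hcb y).smul hcf').aestronglyMeasurable
        (hcf.smul hcβ).aestronglyMeasurable hp1).trans (add_le_add_right (hlow y) _)
    have h2 : eLpNorm (fun t => inner ℝ (bump r (t - y) • f' t + f t • β' (t - y)) v) p volume ≤
        Y y + K * Z := by
      simp only [inner_add_left, real_inner_smul_left]
      exact (eLpNorm_add_le ((hcb y).mul hcv).aestronglyMeasurable
        (hcf.mul (hcβ.inner continuous_const)).aestronglyMeasurable hp1).trans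
        (add_le_add_right (hlowv y) _)
    calc _ ≤ η * (X y + K * Z) + C * ((Y y + K * Z) + Z) := by
          gcongr
          exact hlow0 y
      _ = _ := by rw [hE]; push_cast; ring
  -- Since `q > p`, write `x^q = x^(q-p) x^p`: the first factor is at most `M^(q-p)` for `X` and
  -- `a^(q-p)` for `Y`, while both second factors are at most `X^p`, which integrates well in `y`.
  have hpow : ∀ y, eLpNorm (fun t => bump r (t - y) * f t) q volume ^ (q : ℝ) ≤
      3 ^ (q : ℝ) * (((η : ℝ≥0∞) ^ (q : ℝ) * (M : ℝ≥0∞) ^ ((q : ℝ) - p) +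
        (C : ℝ≥0∞) ^ (q : ℝ) * (a : ℝ≥0∞) ^ ((q : ℝ) - p)) * X y ^ (p : ℝ) +
          (E : ℝ≥0∞) ^ (q : ℝ) * (d : ℝ≥0∞) ^ (q : ℝ)) := by
    intro y
    refine (ENNReal.rpow_le_rpow (hsob y) hQ.le).trans ((ENNReal.add_add_rpow_le hQ.le _ _ _).trans ?_)
    have hsplit : ∀ x : ℝ≥0∞, x ^ (q : ℝ) = x ^ ((q : ℝ) - p) * x ^ (p : ℝ) := fun x => by
      rw [← ENNReal.rpow_add_of_nonneg _ _ hQP.le hP.le, sub_add_cancel]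
    rw [ENNReal.mul_rpow_of_nonneg _ _ hQ.le, ENNReal.mul_rpow_of_nonneg _ _ hQ.le,
      ENNReal.mul_rpow_of_nonneg _ _ hQ.le, hsplit (X y), hsplit (Y y), add_mul, mul_assoc, mul_assoc]
    gcongr
    · exact hXM y
    · exact hloc y
    · exact hYX y
  -- Averaging over all centres `y` takes the place of a covering with bounded overlap.
  have hint : V * eLpNorm f q volume ^ (q : ℝ) ≤
      ∫⁻ y, eLpNorm (fun t => bump r (t - y) * f t) q volume ^ (q : ℝ) := by
    have h1 : ∀ y, eLpNorm (fun t => bump r (t - y) * f t) q volume ^ (q : ℝ) =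
        ∫⁻ x, ‖bump r (x - y)‖ₑ ^ (q : ℝ) * ‖f x‖ₑ ^ (q : ℝ) := fun y => by
      rw [eLpNorm_nnreal_pow_eq_lintegral hq0.ne']
      simp_rw [enorm_mul, ENNReal.mul_rpow_of_nonneg _ _ hQ.le]
    simp_rw [h1]
    rw [lintegral_lintegral_translate_mul (b := fun x => ‖bump r x‖ₑ ^ (q : ℝ))
      (h := fun x => ‖f x‖ₑ ^ (q : ℝ)) ((continuous_bump r).measurable.enorm.pow_const _)
      (hcf.measurable.enorm.pow_const _), eLpNorm_nnreal_pow_eq_lintegral hq0.ne']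
    gcongr
    exact volume_closedBall_le_lintegral_bump hr hr'
  have hintX : ∫⁻ y, X y ^ (p : ℝ) ≤ 2 ^ n * V * (M : ℝ≥0∞) ^ (p : ℝ) := by
    have h1 : ∀ y, X y ^ (p : ℝ) =
        ∫⁻ x, ‖bump r (x - y)‖ₑ ^ (p : ℝ) * ‖f' x‖ₑ ^ (p : ℝ) := fun y => by
      rw [hX, eLpNorm_nnreal_pow_eq_lintegral hp0.ne']
      simp_rw [enorm_smul, ENNReal.mul_rpow_of_nonneg _ _ hP.le]
    simp_rw [h1]
    rw [lintegral_lintegral_translate_mul (b := fun x => ‖bump r x‖ₑ ^ (p : ℝ))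
      (h := fun x => ‖f' x‖ₑ ^ (p : ℝ)) ((continuous_bump r).measurable.enorm.pow_const _)
      (hcf'.measurable.enorm.pow_const _), ← eLpNorm_nnreal_pow_eq_lintegral (f := f') hp0.ne', ← hV2]
    gcongr
    exact lintegral_bump_le_volume_closedBall hP hr hr'
  have hfinal : V * eLpNorm f q volume ^ (q : ℝ) ≤ V * (ε : ℝ≥0∞) ^ (q : ℝ) := by
    refine hint.trans ((lintegral_mono hpow).trans ?_)
    rw [lintegral_const_mul' _ _ (by finiteness), lintegral_add_right _ measurable_const,
      lintegral_const_mul' _ _ (by finiteness), lintegral_const, measure_univ, mul_one]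
    have hd2 : 3 ^ (q : ℝ) * ((E : ℝ≥0∞) ^ (q : ℝ) * (d : ℝ≥0∞) ^ (q : ℝ)) ≤ V * δ := by
      refine le_trans (le_of_eq ?_) (mul_le_mul_right hd' V)
      rw [ENNReal.div_eq_inv_mul, ← mul_assoc V, ← mul_assoc V, ENNReal.mul_inv_cancel hV0 hVt]
      ring
    calc _ ≤ 3 ^ (q : ℝ) * (((η : ℝ≥0∞) ^ (q : ℝ) * (M : ℝ≥0∞) ^ ((q : ℝ) - p) +
        (C : ℝ≥0∞) ^ (q : ℝ) * (a : ℝ≥0∞) ^ ((q : ℝ) - p)) *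
          (2 ^ n * V * (M : ℝ≥0∞) ^ (p : ℝ)) +
          (E : ℝ≥0∞) ^ (q : ℝ) * (d : ℝ≥0∞) ^ (q : ℝ)) := by gcongr
      _ = V * (3 ^ (q : ℝ) * 2 ^ n * ((M : ℝ≥0∞) ^ ((q : ℝ) - p) * (M : ℝ≥0∞) ^ (p : ℝ)) *
            (η : ℝ≥0∞) ^ (q : ℝ)) +
          V * (3 ^ (q : ℝ) * 2 ^ n * ((C : ℝ≥0∞) ^ (q : ℝ) * (M : ℝ≥0∞) ^ (p : ℝ)) *
            (a : ℝ≥0∞) ^ ((q : ℝ) - p)) +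
          3 ^ (q : ℝ) * ((E : ℝ≥0∞) ^ (q : ℝ) * (d : ℝ≥0∞) ^ (q : ℝ)) := by ring
      _ ≤ V * δ + V * δ + V * δ := by gcongr
      _ = V * (ε : ℝ≥0∞) ^ (q : ℝ) := by
          rw [← mul_add, ← mul_add, hδdef, ENNReal.add_thirds]
  rw [ENNReal.mul_le_mul_iff_right hV0 hVt] at hfinal
  exact (ENNReal.rpow_le_rpow_iff hQ).1 hfinal

end Torus

/-! ### Translations and mollification in `L^p`. -/

/-- Averages of functions of bounded `L^p` norm obey the same bound. -/
theorem eLpNorm_integral_le {α Z F : Type*} [MeasurableSpace α] [MeasurableSpace Z]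
    [NormedAddCommGroup F] [NormedSpace ℝ F] {μ : Measure α} [SFinite μ] {P : Measure Z}
    [IsProbabilityMeasure P] {f : α → Z → F}
    (hf : AEStronglyMeasurable (Function.uncurry f) (μ.prod P)) {p : ℝ≥0} (hp : 1 ≤ p)
    {A : ℝ≥0∞} (hA : ∀ᵐ z ∂P, eLpNorm (fun x => f x z) p μ ≤ A) :
    eLpNorm (fun x => ∫ z, f x z ∂P) p μ ≤ A := by
  have hp0 : p ≠ 0 := (zero_lt_one.trans_le hp).ne'
  have hP : (0 : ℝ) < p := zero_lt_one.trans_le hp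
  rw [← ENNReal.rpow_le_rpow_iff hP, eLpNorm_nnreal_pow_eq_lintegral hp0]
  calc ∫⁻ x, ‖∫ z, f x z ∂P‖ₑ ^ (p : ℝ) ∂μ
      ≤ ∫⁻ x, ∫⁻ z, ‖f x z‖ₑ ^ (p : ℝ) ∂P ∂μ := by
        refine lintegral_mono_ae ?_
        filter_upwards [hf.prodMk_left] with x hx
        -- Jensen's inequality, in the form that `L^p` norms for a probability measure increase with
        -- `p`; Tonelli then concludes.
        have h1 : ‖∫ z, f x z ∂P‖ₑ ≤ eLpNorm (f x) p P :=
          (enorm_integral_le_lintegral_enorm _).trans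
            (eLpNorm_one_eq_lintegral_enorm.symm.trans_le
              (eLpNorm_le_eLpNorm_of_exponent_le (by exact_mod_cast hp) hx))
        rw [← eLpNorm_nnreal_pow_eq_lintegral hp0]
        gcongr
    _ = ∫⁻ z, ∫⁻ x, ‖f x z‖ₑ ^ (p : ℝ) ∂μ ∂P :=
        lintegral_lintegral_swap (hf.enorm.pow_const _)
    _ ≤ ∫⁻ _z, A ^ (p : ℝ) ∂P := by
        refine lintegral_mono_ae ?_
        filter_upwards [hA] with z hz
        rw [← eLpNorm_nnreal_pow_eq_lintegral hp0]
        gcongr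
    _ = A ^ (p : ℝ) := by simp

namespace Torus

variable {n : ℕ} {F : Type*} [NormedAddCommGroup F]

theorem measurePreserving_sub_right (z : Torus n) :
    MeasurePreserving (fun x : Torus n => x - z) volume volume :=
  MeasureTheory.measurePreserving_sub_right volume z

theorem eLpNorm_comp_sub_right {u : Torus n → F} (hu : AEStronglyMeasurable u volume) (p : ℝ≥0∞)
    (z : Torus n) : eLpNorm (fun x => u (x - z)) p volume = eLpNorm u p volume :=
  eLpNorm_comp_measurePreserving hu (measurePreserving_sub_right z)

/-- Translation is continuous in `L^p`. -/
theorem tendsto_eLpNorm_translate_sub {p : ℝ≥0∞} (hp : 1 ≤ p) (hpt : p ≠ ⊤) {u : Torus n → F}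
    (hu : MemLp u p volume) :
    Tendsto (fun z : Torus n => eLpNorm (fun x => u (x - z) - u x) p volume) (𝓝 0) (𝓝 0) := by
  have : Fact (1 ≤ p) := ⟨hp⟩
  -- Currying subtraction gives translations depending continuously on `z` in the compact-open
  -- topology, as needed for continuity of composition in `L^p`.
  let g : C(Torus n, C(Torus n, Torus n)) :=
    ContinuousMap.curry ⟨fun a : Torus n × Torus n => a.2 - a.1, by fun_prop⟩
  have hg : ∀ z, MeasurePreserving (g z) volume volume := fun z => measurePreserving_sub_right z
  have h := (Filter.Tendsto.compMeasurePreservingLp (μ := volume) (ν := volume)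
    (f := fun _ : Torus n => hu.toLp u) tendsto_const_nhds
    (g.continuous.tendsto 0) hg (hg 0) hpt)
  rw [Lp.tendsto_Lp_iff_tendsto_eLpNorm'] at h
  refine h.congr fun z => eLpNorm_congr_ae ?_
  have h1 := Lp.coeFn_compMeasurePreserving (hu.toLp u) (hg z)
  have h0 := Lp.coeFn_compMeasurePreserving (hu.toLp u) (hg 0)
  have h2 := (hg z).quasiMeasurePreserving.ae_eq_comp hu.coeFn_toLp
  have h3 := (hg 0).quasiMeasurePreserving.ae_eq_comp hu.coeFn_toLp
  filter_upwards [h1, h0, h2, h3] with x e1 e0 e2 e3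
  rw [Pi.sub_apply, e1, e0, e2, e3]
  simp [g]

/-- The normalized bump. -/
def mollifier (r : ℝ) (t : Torus n) : ℝ := bump r t / ∫ s : Torus n, bump r s

theorem continuous_mollifier (r : ℝ) : Continuous (mollifier r : Torus n → ℝ) :=
  (continuous_bump r).div_const _

theorem isSmooth_mollifier (r : ℝ) : IsSmooth (mollifier r : Torus n → ℝ) :=
  ContDiff.div_const (isSmooth_bump r) _

theorem mollifier_nonneg (r : ℝ) (t : Torus n) : 0 ≤ mollifier r t :=
  div_nonneg (bump_nonneg r t) (integral_nonneg (bump_nonneg r))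

theorem integrable_of_continuous {f : Torus n → F} (hf : Continuous f) : Integrable f volume :=
  hf.integrable_of_hasCompactSupport (HasCompactSupport.of_compactSpace f)

theorem integral_mollifier {r : ℝ} (hr : 0 < r) (hr' : r ≤ 1 / 4) :
    ∫ t : Torus n, mollifier r t = 1 := by
  have : (0 : ℝ) < ∫ s : Torus n, bump r s := by
    refine (continuous_bump r).integral_pos_of_hasCompactSupport_nonneg_nonzero
      (HasCompactSupport.of_compactSpace _) (bump_nonneg r) (x := 0) ?_
    rw [bump_eq_one hr hr' (by simpa using hr.le)]
    exact one_ne_zero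
  unfold mollifier
  rw [integral_div, div_self (ne_of_gt this)]

/-- The probability measure whose density is the mollifier. -/
def mollifierMeasure (n : ℕ) (r : ℝ) : Measure (Torus n) :=
  volume.withDensity fun t => ((mollifier r t).toNNReal : ℝ≥0∞)

theorem isProbabilityMeasure_mollifierMeasure {r : ℝ} (hr : 0 < r) (hr' : r ≤ 1 / 4) :
    IsProbabilityMeasure (mollifierMeasure n r) := by
  constructor
  rw [mollifierMeasure, withDensity_apply _ MeasurableSet.univ, Measure.restrict_univ]
  have := ofReal_integral_eq_lintegral_ofReal (μ := volume)
    (integrable_of_continuous (continuous_mollifier (n := n) r))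
    (.of_forall (mollifier_nonneg r))
  rw [integral_mollifier hr hr', ENNReal.ofReal_one] at this
  exact this.symm

theorem ae_mollifierMeasure {r : ℝ} (hr : 0 < r) (hr' : r ≤ 1 / 4) :
    ∀ᵐ z ∂mollifierMeasure n r, ‖z‖ ≤ 2 * r := by
  rw [mollifierMeasure, ae_withDensity_iff
    (continuous_mollifier r).measurable.real_toNNReal.coe_nnreal_ennreal]
  refine .of_forall fun z hz => ?_
  by_contra! h
  exact hz (by simp [mollifier, bump_eq_zero hr hr' h.le])

variable [NormedSpace ℝ F]

/-- Convolution with the mollifier. -/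
def mollify (r : ℝ) (u : Torus n → F) (x : Torus n) : F := ∫ y, mollifier r (x - y) • u y

/-- Seen as an average of translates over a probability measure, mollification has its error
governed by `eLpNorm_integral_le`. -/
theorem mollify_eq_integral_mollifierMeasure (r : ℝ) (u : Torus n → F) (x : Torus n) :
    mollify r u x = ∫ z, u (x - z) ∂mollifierMeasure n r := by
  rw [mollifierMeasure, integral_withDensity_eq_integral_smul
    (continuous_mollifier r).measurable.real_toNNReal, mollify]
  have := integral_sub_left_eq_self (fun z => (mollifier r z).toNNReal • u (x - z)) volume x
  rw [← this]
  simp [NNReal.smul_def, mollifier_nonneg]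

theorem integrable_mollifier_smul (r : ℝ) {u : Torus n → F} (hu : Integrable u volume)
    (x : Torus n) : Integrable (fun y => mollifier r (x - y) • u y) volume := by
  obtain ⟨K, hK⟩ := isCompact_univ.exists_bound_of_continuousOn
    (continuous_mollifier (n := n) r).continuousOn
  refine hu.bdd_smul K ?_ (.of_forall fun y => hK _ trivial)
  exact ((continuous_mollifier r).comp (continuous_const.sub continuous_id)).aestronglyMeasurable

theorem continuous_mollify (r : ℝ) {u : Torus n → F} (hu : Integrable u volume) :
    Continuous (mollify r u) := by
  obtain ⟨K, hK⟩ := isCompact_univ.exists_bound_of_continuousOn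
    (continuous_mollifier (n := n) r).continuousOn
  refine continuous_of_dominated (bound := fun y => K * ‖u y‖)
    (fun x => (integrable_mollifier_smul r hu x).aestronglyMeasurable) (fun x => ?_)
    (hu.norm.const_mul K) ?_
  · refine .of_forall fun y => ?_
    rw [norm_smul]
    gcongr
    exact hK _ trivial
  · refine .of_forall fun y => ?_
    exact ((continuous_mollifier r).comp (continuous_id.sub continuous_const)).smul continuous_const

/-- The error of mollification is controlled by small translations. -/
theorem eLpNorm_mollify_sub_le {p : ℝ≥0} (hp : 1 ≤ p) {u : Torus n → F} (hu : Integrable u volume)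
    [CompleteSpace F] {r : ℝ} (hr : 0 < r) (hr' : r ≤ 1 / 4) {A : ℝ≥0∞}
    (hA : ∀ z : Torus n, ‖z‖ ≤ 2 * r → eLpNorm (fun x => u (x - z) - u x) p volume ≤ A) :
    eLpNorm (mollify r u - u) p volume ≤ A := by
  have := isProbabilityMeasure_mollifierMeasure (n := n) hr hr'
  have hac : mollifierMeasure n r ≪ volume := withDensity_absolutelyContinuous _ _
  have hmeas : AEStronglyMeasurable (Function.uncurry fun x z : Torus n => u (x - z) - u x)
      ((volume : Measure (Torus n)).prod (mollifierMeasure n r)) := by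
    have h1 : AEStronglyMeasurable (fun a : Torus n × Torus n => u (a.1 - a.2))
        ((volume : Measure (Torus n)).prod volume) :=
      hu.aestronglyMeasurable.comp_quasiMeasurePreserving
        (quasiMeasurePreserving_sub_of_right_invariant volume volume)
    exact (h1.mono_ac (Measure.AbsolutelyContinuous.rfl.prod hac)).sub hu.aestronglyMeasurable.comp_fst
  refine le_trans (le_of_eq (congrArg (fun h => eLpNorm h p volume) ?_)) (eLpNorm_integral_le
    (f := fun x z : Torus n => u (x - z) - u x) hmeas hp
    ((ae_mollifierMeasure hr hr').mono fun z hz => hA z hz))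
  funext x
  rw [integral_sub _ (integrable_const _), integral_const, Pi.sub_apply,
    mollify_eq_integral_mollifierMeasure]
  · simp
  · rw [mollifierMeasure, integrable_withDensity_iff_integrable_smul
      (continuous_mollifier r).measurable.real_toNNReal]
    have h2 := (integrable_mollifier_smul r hu x).comp_sub_left x
    simpa [NNReal.smul_def, mollifier_nonneg] using h2

theorem tendsto_eLpNorm_mollify_sub {p : ℝ≥0} (hp : 1 ≤ p) [CompleteSpace F] {u : Torus n → F}
    (hu : MemLp u p volume) :
    Tendsto (fun r => eLpNorm (mollify r u - u) p volume) (𝓝[>] 0) (𝓝 0) := by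
  rw [ENNReal.tendsto_nhds_zero]
  intro ε hε
  have h1 := tendsto_eLpNorm_translate_sub (by exact_mod_cast hp) ENNReal.coe_ne_top hu
  obtain ⟨δ, hδ, hδ'⟩ := Metric.eventually_nhds_iff.1 (ENNReal.tendsto_nhds_zero.1 h1 ε hε)
  have h2 : ∀ᶠ r : ℝ in 𝓝[>] 0, r < min (1 / 4) (δ / 2) :=
    (gt_mem_nhds (lt_min (by norm_num) (by positivity))).filter_mono nhdsWithin_le_nhds
  filter_upwards [h2, self_mem_nhdsWithin] with r hr hr0
  refine eLpNorm_mollify_sub_le hp (hu.integrable (by exact_mod_cast hp)) hr0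
    (hr.le.trans (min_le_left _ _)) fun z hz => hδ' ?_
  rw [dist_zero_right]
  have := hr.trans_le (min_le_right _ _)
  linarith

/-- The mollification of a weakly differentiable function is continuously differentiable. -/
theorem IsWeakGradient.hasC1Deriv_mollify {w : Torus n → ℝ} {G : Torus n → EuclideanSpace ℝ (Fin n)}
    (h : IsWeakGradient w G) (hw : Integrable w volume) (hG : Integrable G volume) (r : ℝ) :
    HasC1Deriv (mollify r w) (mollify r G) where
  continuous_deriv := continuous_mollify r hG
  hasFDerivAt x := by
    obtain ⟨ρ', hρ⟩ := (isSmooth_mollifier (n := n) r).exists_hasC1Deriv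
    obtain ⟨K, hK⟩ := isCompact_univ.exists_bound_of_continuousOn hρ.continuous_deriv.continuousOn
    have hcρ' : Continuous fun y => ρ' (mk x - y) :=
      hρ.continuous_deriv.comp (continuous_sub_left _)
    have hint : Integrable (fun y => w y • ρ' (mk x - y)) volume :=
      hw.smul_bdd K hcρ'.aestronglyMeasurable (.of_forall fun y => hK _ trivial)
    have key := hasFDerivAt_integral_of_dominated_of_fderiv_le (𝕜 := ℝ) (μ := volume) (x₀ := x)
      (F := fun x y => mollifier r (mk x - y) • w y)
      (F' := fun x y => w y • innerSL ℝ (ρ' (mk x - y))) (bound := fun y => ‖w y‖ * K)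
      (s := Set.univ) univ_mem
      (.of_forall fun x => (integrable_mollifier_smul r hw _).aestronglyMeasurable)
      (integrable_mollifier_smul r hw _)
      (by
        have := ((innerSL ℝ).continuous.comp hcρ').aestronglyMeasurable (μ := volume)
        exact hw.aestronglyMeasurable.smul this)
      (.of_forall fun y x _ => by
        rw [norm_smul, innerSL_apply_norm]
        gcongr
        exact hK _ trivial)
      (hw.norm.mul_const K)
      (.of_forall fun y x _ => by
        have := ((hρ.comp_sub_const y).hasFDerivAt x).mul_const (w y)
        exact this)
    refine key.congr_fderiv ?_
    have h1 : ∫ y, w y • innerSL ℝ (ρ' (mk x - y)) = innerSL ℝ (∫ y, w y • ρ' (mk x - y)) := by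
      rw [← ContinuousLinearMap.integral_comp_comm _ hint]
      simp
    rw [h1]
    congr 1
    ext i
    have hproj : ∀ f : Torus n → EuclideanSpace ℝ (Fin n), Integrable f volume →
        (∫ y, f y) i = ∫ y, f y i := fun f hf =>
      ((EuclideanSpace.proj i : EuclideanSpace ℝ (Fin n) →L[ℝ] ℝ).integral_comp_comm hf).symm
    rw [hproj _ hint, mollify, hproj _ (integrable_mollifier_smul r hG _)]
    have hsm : IsSmooth fun y => mollifier r (mk x - y) := by
      unfold IsSmooth
      simp_rw [← mk_sub]
      exact (isSmooth_mollifier r).comp (contDiff_const.sub contDiff_id)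
    have hpd : ∀ y, partialDeriv i (fun y => mollifier r (mk x - y)) y = -(ρ' (mk x - y) i) :=
      fun y => (hρ.comp_const_sub (mk x)).partialDeriv_eq i y
    -- The weak gradient is tested against `y ↦ mollifier r (mk x - y)`; the sign from the
    -- reflection cancels the one from integration by parts.
    have := h _ hsm i
    simp_rw [hpd] at this
    simp only [PiLp.smul_apply, smul_eq_mul]
    simp only [mul_neg, integral_neg, neg_inj] at this
    rw [this]
    simp_rw [mul_comm]

/-- Sobolev functions are limits of continuously differentiable functions. -/
theorem MemSobolev.exists_tendsto_hasC1Deriv {p : ℝ≥0} (hp : 1 ≤ p) {w : Torus n → ℝ}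
    {G : Torus n → EuclideanSpace ℝ (Fin n)} (h : MemSobolev p w G) :
    ∃ (f : ℕ → Torus n → ℝ) (f' : ℕ → Torus n → EuclideanSpace ℝ (Fin n)),
      (∀ m, HasC1Deriv (f m) (f' m)) ∧
      Tendsto (fun m => eLpNorm (f m - w) p volume) atTop (𝓝 0) ∧
      Tendsto (fun m => eLpNorm (f' m - G) p volume) atTop (𝓝 0) := by
  have hp1 : (1 : ℝ≥0∞) ≤ p := by exact_mod_cast hp
  have hr : Tendsto (fun m : ℕ => 1 / ((m : ℝ) + 1)) atTop (𝓝[>] 0) :=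
    tendsto_nhdsWithin_iff.2 ⟨tendsto_one_div_add_atTop_nhds_zero_nat,
      .of_forall fun m => by simpa using Nat.cast_add_one_pos m⟩
  exact ⟨_, _, fun m => h.isWeakGradient.hasC1Deriv_mollify (h.memLp.integrable hp1)
    (h.memLp_grad.integrable hp1) _, (tendsto_eLpNorm_mollify_sub hp h.memLp).comp hr,
    (tendsto_eLpNorm_mollify_sub hp h.memLp_grad).comp hr⟩

/-! ### Translation estimates and Rellich compactness. -/

/-- The increment is the integral of the derivative along a segment lifting `z`, hence an average of
translates of a component of `f'`, and translations preserve the `L^p` norm. -/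
theorem HasC1Deriv.eLpNorm_translate_sub_le {p : ℝ≥0} (hp : 1 ≤ p) {f : Torus n → ℝ}
    {f' : Torus n → EuclideanSpace ℝ (Fin n)} (hf : HasC1Deriv f f') (z : Torus n) :
    eLpNorm (fun x => f (x - z) - f x) p volume ≤
      ENNReal.ofReal (√n * ‖z‖) * eLpNorm f' p volume := by
  obtain ⟨h, rfl, hh⟩ := exists_mk_eq_norm_le z
  have hcont : Continuous fun a : Torus n × ℝ => inner ℝ (f' (a.1 - mk (a.2 • h))) (-h) := by
    refine (hf.continuous_deriv.comp (continuous_fst.sub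
      (continuous_mk.comp (continuous_snd.smul continuous_const)))).inner continuous_const
  let P : Measure ℝ := volume.restrict (Set.Ioc 0 1)
  have : IsProbabilityMeasure P := ⟨by simp [P]⟩
  have hftc : ∀ x, f (x - mk h) - f x = ∫ s, inner ℝ (f' (x - mk (s • h))) (-h) ∂P := by
    intro x
    obtain ⟨x, rfl⟩ := surjective_mk x
    have hd : ∀ s ∈ Set.uIcc (0 : ℝ) 1, HasDerivAt (fun s : ℝ => f (mk (x - s • h)))
        (inner ℝ (f' (mk x - mk (s • h))) (-h)) s := by
      intro s _
      have e2 : HasDerivAt (fun s : ℝ => x - s • h) (-h) s := by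
        simpa using ((hasDerivAt_id s).smul_const h).const_sub x
      have e3 := (hf.hasFDerivAt (x - s • h)).comp_hasDerivAt s e2
      rw [mk_sub] at e3
      exact e3
    have h1 := intervalIntegral.integral_eq_sub_of_hasDerivAt hd
      (((hcont.comp (by fun_prop : Continuous fun s : ℝ => (mk x, s)))).intervalIntegrable 0 1)
    rw [intervalIntegral.integral_of_le zero_le_one] at h1
    rw [h1]
    simp [mk_sub]
  simp_rw [hftc]
  refine eLpNorm_integral_le (f := fun x s => inner ℝ (f' (x - mk (s • h))) (-h))
    (P := P) hcont.aestronglyMeasurable hp (.of_forall fun s => ?_)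
  calc eLpNorm (fun x => inner ℝ (f' (x - mk (s • h))) (-h)) p volume
      ≤ ‖h‖₊ • eLpNorm (fun x => f' (x - mk (s • h))) p volume := by
        refine eLpNorm_le_nnreal_smul_eLpNorm_of_ae_le_mul (.of_forall fun x => ?_) _
        rw [mul_comm]
        simpa using nnnorm_inner_le_nnnorm (𝕜 := ℝ) (f' (x - mk (s • h))) (-h)
    _ = ‖h‖₊ • eLpNorm f' p volume := by
        rw [eLpNorm_comp_sub_right hf.continuous_deriv.aestronglyMeasurable]
    _ ≤ _ := by
        rw [ENNReal.smul_def, smul_eq_mul]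
        gcongr
        rw [← enorm_eq_nnnorm, ← ofReal_norm]
        exact ENNReal.ofReal_le_ofReal hh

theorem MemSobolev.eLpNorm_translate_sub_le {p : ℝ≥0} (hp : 1 ≤ p) {w : Torus n → ℝ}
    {G : Torus n → EuclideanSpace ℝ (Fin n)} (h : MemSobolev p w G) (z : Torus n) :
    eLpNorm (fun x => w (x - z) - w x) p volume ≤
      ENNReal.ofReal (√n * ‖z‖) * eLpNorm G p volume := by
  have hp1 : (1 : ℝ≥0∞) ≤ p := by exact_mod_cast hp
  obtain ⟨f, f', hf, hfw, hfG⟩ := h.exists_tendsto_hasC1Deriv hp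
  have hL : ENNReal.ofReal (√n * ‖z‖) ≠ ⊤ := ENNReal.ofReal_ne_top
  set L := ENNReal.ofReal (√n * ‖z‖)
  have hlim : Tendsto (fun m => eLpNorm (f m - w) p volume + L * (eLpNorm (f' m - G) p volume +
      eLpNorm G p volume) + eLpNorm (f m - w) p volume) atTop (𝓝 (L * eLpNorm G p volume)) := by
    have := (hfw.add (ENNReal.Tendsto.const_mul (hfG.add_const (eLpNorm G p volume))
      (Or.inr hL))).add hfw
    simpa only [zero_add, add_zero] using this
  refine ge_of_tendsto' hlim fun m => ?_
  have hmw := h.memLp.aestronglyMeasurable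
  have hmf := (hf m).continuous.aestronglyMeasurable (μ := volume)
  have hmfw := hmf.sub hmw
  have htr : ∀ {u : Torus n → ℝ}, AEStronglyMeasurable u volume →
      AEStronglyMeasurable (fun x => u (x - z)) volume := fun hu =>
    hu.comp_measurePreserving (measurePreserving_sub_right z)
  have e : (fun x => w (x - z) - w x) =
      (-(fun x => (f m - w) (x - z)) + fun x => f m (x - z) - f m x) + (f m - w) := by
    funext x; simp
  rw [e]
  refine (eLpNorm_add_le ((htr hmfw).neg.add ((htr hmf).sub hmf)) hmfw hp1).trans ?_
  gcongr
  refine (eLpNorm_add_le (htr hmfw).neg ((htr hmf).sub hmf) hp1).trans ?_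
  rw [eLpNorm_neg, eLpNorm_comp_sub_right hmfw]
  gcongr
  refine ((hf m).eLpNorm_translate_sub_le hp z).trans ?_
  gcongr
  have := eLpNorm_add_le (((hf m).continuous_deriv.aestronglyMeasurable (μ := volume)).sub
    h.memLp_grad.aestronglyMeasurable) h.memLp_grad.aestronglyMeasurable hp1
  rwa [sub_add_cancel] at this

theorem norm_mollify_sub_mollify_le (r : ℝ) {u : Torus n → ℝ} (hu : Integrable u volume)
    {x x' : Torus n} {ε : ℝ} (hε : ∀ y, |mollifier r (x - y) - mollifier r (x' - y)| ≤ ε) :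
    ‖mollify r u x - mollify r u x'‖ ≤ ε * ∫ y, ‖u y‖ := by
  rw [mollify, mollify, ← integral_sub (integrable_mollifier_smul r hu x)
    (integrable_mollifier_smul r hu x'), ← integral_const_mul]
  refine norm_integral_le_of_norm_le (hu.norm.const_mul _) (.of_forall fun y => ?_)
  rw [← sub_smul, norm_smul]
  gcongr
  exact hε y

/-- The mollifications of an `L¹`-bounded family form a totally bounded set in `L^p`. -/
theorem totallyBounded_range_mollify {p : ℝ≥0∞} [Fact (1 ≤ p)] (r : ℝ) {u : ℕ → Torus n → ℝ}
    (hu : ∀ k, Integrable (u k) volume) {C : ℝ} (hC : ∀ k, ∫ y, ‖u k y‖ ≤ C)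
    (hm : ∀ k, MemLp (mollify r (u k)) p volume) :
    TotallyBounded (Set.range fun k => (hm k).toLp) := by
  have hC0 : 0 ≤ C := (integral_nonneg fun _ => norm_nonneg _).trans (hC 0)
  obtain ⟨K, hK⟩ := isCompact_univ.exists_bound_of_continuousOn
    (continuous_mollifier (n := n) r).continuousOn
  have hK0 : 0 ≤ K := (norm_nonneg _).trans (hK 0 trivial)
  let b : ℕ → BoundedContinuousFunction (Torus n) ℝ := fun k =>
    BoundedContinuousFunction.mkOfCompact ⟨mollify r (u k), continuous_mollify r (hu k)⟩
  have hb : ∀ k x, b k x = mollify r (u k) x := fun _ _ => rfl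
  have hcpt : IsCompact (closure (Set.range b)) := by
    -- Arzelà–Ascoli: the mollifier's supremum and modulus of continuity, together with the `L¹`
    -- bound, control the whole family.
    refine BoundedContinuousFunction.arzela_ascoli (Metric.closedBall 0 (K * C))
      (isCompact_closedBall _ _) _ ?_ ?_
    · rintro _ x ⟨k, rfl⟩
      rw [mem_closedBall_zero_iff, hb, mollify]
      refine (norm_integral_le_of_norm_le ((hu k).norm.const_mul K) (.of_forall fun y => ?_)).trans
        ?_
      · rw [norm_smul]
        gcongr
        exact hK _ trivial
      · rw [integral_const_mul]
        gcongr
        exact hC k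
    · refine UniformEquicontinuous.equicontinuous ?_
      rw [Metric.uniformEquicontinuous_iff]
      intro ε hε
      have huc := CompactSpace.uniformContinuous_of_continuous (continuous_mollifier (n := n) r)
      obtain ⟨δ, hδ, hδ'⟩ := Metric.uniformContinuous_iff.1 huc (ε / (C + 1)) (by positivity)
      refine ⟨δ, hδ, fun x x' hxx' => ?_⟩
      rintro ⟨_, k, rfl⟩
      change dist (mollify r (u k) x) (mollify r (u k) x') < ε
      rw [dist_eq_norm]
      refine (norm_mollify_sub_mollify_le r (hu k) (ε := ε / (C + 1)) fun y => ?_).trans_lt ?_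
      · rw [← Real.dist_eq]
        exact (hδ' (by simpa using hxx')).le
      · calc ε / (C + 1) * ∫ y, ‖u k y‖ ≤ ε / (C + 1) * C := by gcongr; exact hC k
          _ < ε := by
            rw [div_mul_eq_mul_div, div_lt_iff₀ (by positivity)]
            nlinarith
  have htb : TotallyBounded (Set.range b) := hcpt.totallyBounded.subset subset_closure
  have him := htb.image (BoundedContinuousFunction.toLp (E := ℝ) p (volume : Measure (Torus n))
    ℝ).uniformContinuous
  rw [← Set.range_comp] at him
  convert him using 2
  funext k
  refine Lp.ext ?_
  exact (hm k).coeFn_toLp.trans (BoundedContinuousFunction.coeFn_toLp p volume ℝ (b k)).symm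

/-- Bounded sequences of Sobolev functions have subsequences that converge in `L^p`. -/
theorem exists_subseq_tendsto_of_memSobolev {p : ℝ≥0} (hp : 1 ≤ p) {u : ℕ → Torus n → ℝ}
    {G : ℕ → Torus n → EuclideanSpace ℝ (Fin n)} (hu : ∀ k, MemSobolev p (u k) (G k)) {C : ℝ≥0}
    (hC : ∀ k, sobolevNorm p (u k) (G k) ≤ C) :
    ∃ (σ : ℕ → ℕ) (U : Torus n → ℝ), StrictMono σ ∧ MemLp U p volume ∧
      Tendsto (fun j => eLpNorm (u (σ j) - U) p volume) atTop (𝓝 0) := by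
  have hp1 : (1 : ℝ≥0∞) ≤ p := by exact_mod_cast hp
  have : Fact ((1 : ℝ≥0∞) ≤ p) := ⟨hp1⟩
  have hui : ∀ k, Integrable (u k) volume := fun k => (hu k).memLp.integrable hp1
  have huC : ∀ k, ∫ y, ‖u k y‖ ≤ C := by
    intro k
    rw [integral_norm_eq_lintegral_enorm (hui k).aestronglyMeasurable]
    refine ENNReal.toReal_le_coe_of_le_coe ?_
    rw [← eLpNorm_one_eq_lintegral_enorm]
    exact ((eLpNorm_le_eLpNorm_of_exponent_le hp1 (hui k).aestronglyMeasurable).trans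
      le_self_add).trans (hC k)
  let a : ℕ → Lp ℝ p (volume : Measure (Torus n)) := fun k => (hu k).memLp.toLp
  have htb : TotallyBounded (Set.range a) := by
    rw [Metric.totallyBounded_iff]
    intro ε hε
    -- By the translation estimate, mollifying at scale `r` moves every `u k` by at most `√n * (2 *
    -- r) * C` in `L^p`, so an `ε / 2`-net of the mollified family is an `ε`-net of the original
    -- one.
    obtain ⟨r, hr, hr', hrε⟩ : ∃ r : ℝ, 0 < r ∧ r ≤ 1 / 4 ∧ √n * (2 * r) * C < ε / 2 := by
      refine ⟨min (1 / 4) (ε / (4 * (√n * 2 * C + 1))), by positivity, min_le_left _ _, ?_⟩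
      have h1 := min_le_right (1 / 4) (ε / (4 * (√n * 2 * C + 1)))
      set r := min (1 / 4) (ε / (4 * (√n * 2 * C + 1)))
      have h2 : r * (4 * (√n * 2 * C + 1)) ≤ ε := (le_div_iff₀ (by positivity)).1 h1
      have h3 : 0 < r := by positivity
      nlinarith
    have hm : ∀ k, MemLp (mollify r (u k)) p volume := fun k =>
      (continuous_mollify r (hui k)).memLp_of_hasCompactSupport
        (HasCompactSupport.of_compactSpace _)
    obtain ⟨t, ht, hcov⟩ := Metric.totallyBounded_iff.1
      (totallyBounded_range_mollify r hui huC hm) (ε / 2) (by positivity)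
    refine ⟨t, ht, ?_⟩
    rintro _ ⟨k, rfl⟩
    obtain ⟨y, hy, hky⟩ := Set.mem_iUnion₂.1 (hcov ⟨k, rfl⟩)
    refine Set.mem_iUnion₂.2 ⟨y, hy, ?_⟩
    rw [Metric.mem_ball] at hky ⊢
    have hd : dist (a k) (hm k).toLp < ε / 2 := by
      rw [dist_comm, dist_eq_norm, ← MemLp.toLp_sub, Lp.norm_toLp]
      refine lt_of_le_of_lt (ENNReal.toReal_le_of_le_ofReal (by positivity) ?_) hrε
      refine eLpNorm_mollify_sub_le hp (hui k) hr hr' fun z hz => ?_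
      refine ((hu k).eLpNorm_translate_sub_le hp z).trans ?_
      rw [ENNReal.ofReal_mul (p := √n * (2 * r)) (by positivity), ENNReal.ofReal_coe_nnreal]
      gcongr
      exact (le_add_self).trans (hC k)
    linarith [dist_triangle (a k) (hm k).toLp y]
  have hcpt : IsCompact (closure (Set.range a)) :=
    htb.closure.isCompact_of_isClosed isClosed_closure
  obtain ⟨U, -, σ, hσ, hlim⟩ := hcpt.tendsto_subseq (x := a) fun k => subset_closure ⟨k, rfl⟩
  refine ⟨σ, U, hσ, Lp.memLp U, ?_⟩
  rw [Lp.tendsto_Lp_iff_tendsto_eLpNorm'] at hlim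
  refine hlim.congr fun j => eLpNorm_congr_ae ?_
  exact ((hu (σ j)).memLp.coeFn_toLp).sub (ae_eq_refl _)

/-! ### The localized inequality for Sobolev functions. -/

theorem MemSobolev.sub {p : ℝ≥0∞} (hp : 1 ≤ p) {u w : Torus n → ℝ}
    {G H : Torus n → EuclideanSpace ℝ (Fin n)} (hu : MemSobolev p u G) (hw : MemSobolev p w H) :
    MemSobolev p (u - w) (G - H) := by
  refine ⟨hu.memLp.sub hw.memLp, hu.memLp_grad.sub hw.memLp_grad, fun φ hφ i => ?_⟩
  obtain ⟨φ', h⟩ := hφ.exists_hasC1Deriv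
  have hmul : ∀ {b c : Torus n → ℝ}, Integrable b volume → Continuous c →
      Integrable (fun x => b x * c x) volume := fun hb hc => by
    obtain ⟨K, hK⟩ := isCompact_univ.exists_bound_of_continuousOn hc.continuousOn
    exact hb.smul_bdd K hc.aestronglyMeasurable (.of_forall fun x => hK x trivial)
  have hpd : Continuous (partialDeriv i φ) := by
    rw [funext (h.partialDeriv_eq i)]
    exact (EuclideanSpace.proj i : EuclideanSpace ℝ (Fin n) →L[ℝ] ℝ).continuous.comp
      h.continuous_deriv
  have hcoord : ∀ {G : Torus n → EuclideanSpace ℝ (Fin n)}, MemLp G p volume →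
      Integrable (fun x => G x i) volume := fun hG =>
    (EuclideanSpace.proj i : EuclideanSpace ℝ (Fin n) →L[ℝ] ℝ).integrable_comp (hG.integrable hp)
  simp only [Pi.sub_apply, PiLp.sub_apply, sub_mul]
  rw [integral_sub (hmul (hu.memLp.integrable hp) hpd) (hmul (hw.memLp.integrable hp) hpd),
    integral_sub (hmul (hcoord hu.memLp_grad) h.continuous)
      (hmul (hcoord hw.memLp_grad) h.continuous),
    hu.isWeakGradient φ hφ i, hw.isWeakGradient φ hφ i]
  ring

theorem MemSobolev.const_smul {p : ℝ≥0∞} {u : Torus n → ℝ}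
    {G : Torus n → EuclideanSpace ℝ (Fin n)} (hu : MemSobolev p u G) (c : ℝ) :
    MemSobolev p (c • u) (c • G) := by
  refine ⟨hu.memLp.const_smul c, hu.memLp_grad.const_smul c, fun φ hφ i => ?_⟩
  have := hu.isWeakGradient φ hφ i
  simp only [Pi.smul_apply, PiLp.smul_apply, smul_eq_mul, mul_assoc, integral_const_mul, this,
    mul_neg]

/-- A Sobolev function with small `L^p` norm, whose derivative in one direction is small on every
small ball, has small norm at the Sobolev exponent. -/
theorem MemSobolev.exists_eLpNorm_le_of_localized (hn : 0 < n) {p q : ℝ≥0} (hp : 1 ≤ p)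
    (hpq : (q : ℝ)⁻¹ = (p : ℝ)⁻¹ - (n : ℝ)⁻¹) (hplt : p < q) (v : EuclideanSpace ℝ (Fin n))
    (hv : ‖v‖ = 1) (M : ℝ≥0) {ε : ℝ≥0} (hε : 0 < ε) :
    ∃ a : ℝ≥0, 0 < a ∧ ∀ r : ℝ, 0 < r → r ≤ 1 / 4 → ∃ d : ℝ≥0, 0 < d ∧
      ∀ (w : Torus n → ℝ) (G : Torus n → EuclideanSpace ℝ (Fin n)), MemSobolev p w G →
        eLpNorm G p volume ≤ M →
        (∀ y, eLpNorm (fun t => bump r (t - y) * inner ℝ (G t) v) p volume ≤ a) →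
        eLpNorm w p volume ≤ d → eLpNorm w q volume ≤ ε := by
  have hp1 : (1 : ℝ≥0∞) ≤ p := by exact_mod_cast hp
  have hp0 : (p : ℝ≥0∞) ≠ 0 := (zero_lt_one.trans_le hp1).ne'
  -- The bound `M + 1` and the halved thresholds below leave room for the approximation errors.
  obtain ⟨a, ha, H⟩ := HasC1Deriv.exists_eLpNorm_le_of_localized hn hp hpq hplt v hv (M + 1) hε
  refine ⟨a / 2, half_pos ha, fun r hr hr' => ?_⟩
  obtain ⟨d, hd, H⟩ := H r hr hr'
  refine ⟨d / 2, half_pos hd, fun w G hw hM hloc hwd => ?_⟩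
  obtain ⟨f, f', hf, hfw, hfG⟩ := hw.exists_tendsto_hasC1Deriv hp
  have hmw := hw.memLp.aestronglyMeasurable
  have hmG := hw.memLp_grad.aestronglyMeasurable
  have hev : ∀ᶠ m in atTop, eLpNorm (f m) q volume ≤ ε := by
    have hpos : ∀ {x : ℝ≥0}, 0 < x → (0 : ℝ≥0∞) < x := fun h => by exact_mod_cast h
    filter_upwards [ENNReal.tendsto_nhds_zero.1 hfw (d / 2 : ℝ≥0) (hpos (half_pos hd)),
      ENNReal.tendsto_nhds_zero.1 hfG (a / 2 : ℝ≥0) (hpos (half_pos ha)),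
      ENNReal.tendsto_nhds_zero.1 hfG (1 : ℝ≥0) (by simp)] with m h1 h2 h3
    have hmf := (hf m).continuous.aestronglyMeasurable (μ := volume)
    have hmf' := (hf m).continuous_deriv.aestronglyMeasurable (μ := volume)
    refine H (f m) (f' m) (hf m) ?_ (fun y => ?_) ?_
    · have := eLpNorm_add_le (hmf'.sub hmG) hmG hp1
      rw [sub_add_cancel] at this
      refine this.trans ((add_le_add h3 hM).trans ?_)
      push_cast
      rw [add_comm]
    · have hb : AEStronglyMeasurable (fun t : Torus n => bump r (t - y)) volume :=
        ((continuous_bump r).comp (continuous_id.sub continuous_const)).aestronglyMeasurable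
      have e : (fun t => bump r (t - y) * inner ℝ (f' m t) v) =
          (fun t => bump r (t - y) * inner ℝ ((f' m - G) t) v) +
            fun t => bump r (t - y) * inner ℝ (G t) v := by
        funext t
        simp [inner_sub_left]
        ring
      rw [e]
      refine (eLpNorm_add_le (hb.mul ((hmf'.sub hmG).inner aestronglyMeasurable_const))
        (hb.mul (hmG.inner aestronglyMeasurable_const)) hp1).trans ?_
      have h4 : eLpNorm (fun t => bump r (t - y) * inner ℝ ((f' m - G) t) v) p volume ≤
          (a / 2 : ℝ≥0) := by
        refine (eLpNorm_mono fun t => ?_).trans h2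
        rw [norm_mul, Real.norm_of_nonneg (bump_nonneg _ _)]
        refine (mul_le_of_le_one_left (norm_nonneg _) (bump_le_one _ _)).trans ?_
        simpa [hv] using norm_inner_le_norm (𝕜 := ℝ) ((f' m - G) t) v
      refine (add_le_add h4 (hloc y)).trans (le_of_eq ?_)
      rw [← ENNReal.coe_add, add_halves]
    · have := eLpNorm_add_le (hmf.sub hmw) hmw hp1
      rw [sub_add_cancel] at this
      refine this.trans ((add_le_add h1 hwd).trans (le_of_eq ?_))
      rw [← ENNReal.coe_add, add_halves]
  -- The approximations converge only in `L^p`; the `L^q` bound passes to the limit by Fatou along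
  -- an almost everywhere convergent subsequence.
  have htm := tendstoInMeasure_of_tendsto_eLpNorm hp0
    (fun m => (hf m).continuous.aestronglyMeasurable) hmw hfw
  obtain ⟨ns, hns, hae⟩ := htm.exists_seq_tendsto_ae
  exact Lp.eLpNorm_le_of_ae_tendsto (hns.tendsto_atTop.eventually hev)
    (fun m => (hf _).continuous.aestronglyMeasurable) hae

end Torus

/-! ### Strong convergence and convergence of norms. -/

theorem tendsto_eLpNorm_of_tendsto_eLpNorm_sub {α F : Type*} [MeasurableSpace α]
    [NormedAddCommGroup F] {μ : Measure α} {q : ℝ≥0∞} (hq : 1 ≤ q) {u : ℕ → α → F} {U : α → F}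
    (hu : ∀ j, AEStronglyMeasurable (u j) μ) (hU : MemLp U q μ)
    (h : Tendsto (fun j => eLpNorm (u j - U) q μ) atTop (𝓝 0)) :
    Tendsto (fun j => eLpNorm (u j) q μ) atTop (𝓝 (eLpNorm U q μ)) := by
  have hU' := hU.aestronglyMeasurable
  refine tendsto_of_tendsto_of_tendsto_of_le_of_le
    (g := fun j => eLpNorm U q μ - eLpNorm (u j - U) q μ)
    (h := fun j => eLpNorm (u j - U) q μ + eLpNorm U q μ) ?_ ?_ (fun j => ?_) (fun j => ?_)
  · simpa using ENNReal.Tendsto.sub tendsto_const_nhds h (Or.inl hU.eLpNorm_ne_top)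
  · simpa using h.add_const (eLpNorm U q μ)
  · rw [tsub_le_iff_right]
    have := eLpNorm_add_le (hu j) (hU'.sub (hu j)) hq
    rwa [add_sub_cancel, eLpNorm_sub_comm] at this
  · have := eLpNorm_add_le ((hu j).sub hU') hU' hq
    rwa [sub_add_cancel] at this

/-- Almost everywhere convergence and convergence of the norms imply strong convergence. -/
theorem tendsto_lintegral_enorm_sub_of_ae {α : Type*} [MeasurableSpace α] {μ : Measure α} {q : ℝ}
    (hq : 0 < q) {u : ℕ → α → ℝ} {w : α → ℝ} (hu : ∀ k, AEStronglyMeasurable (u k) μ)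
    (hw : AEStronglyMeasurable w μ) (hwf : ∫⁻ x, ‖w x‖ₑ ^ q ∂μ ≠ ⊤)
    (hae : ∀ᵐ x ∂μ, Tendsto (fun k => u k x) atTop (𝓝 (w x)))
    (hnorm : Tendsto (fun k => ∫⁻ x, ‖u k x‖ₑ ^ q ∂μ) atTop (𝓝 (∫⁻ x, ‖w x‖ₑ ^ q ∂μ))) :
    Tendsto (fun k => ∫⁻ x, ‖u k x - w x‖ₑ ^ q ∂μ) atTop (𝓝 0) := by
  -- The constant comes from the three-term inequality `ENNReal.add_add_rpow_le`, used with one term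
  -- equal to `0`.
  set c : ℝ≥0∞ := 3 ^ q with hc
  have hct : c ≠ ⊤ := by finiteness
  set b : ℕ → α → ℝ≥0∞ := fun k x => c * (‖u k x‖ₑ ^ q + ‖w x‖ₑ ^ q) with hb
  set e : ℕ → α → ℝ≥0∞ := fun k x => ‖u k x - w x‖ₑ ^ q with he
  set I := ∫⁻ x, ‖w x‖ₑ ^ q ∂μ with hI
  have hle : ∀ k x, e k x ≤ b k x := by
    intro k x
    have h1 := ENNReal.add_add_rpow_le hq.le ‖u k x‖ₑ ‖w x‖ₑ 0
    rw [ENNReal.zero_rpow_of_pos hq, add_zero, add_zero] at h1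
    exact (ENNReal.rpow_le_rpow enorm_sub_le hq.le).trans h1
  have hmu : ∀ k, AEMeasurable (fun x => ‖u k x‖ₑ ^ q) μ := fun k => (hu k).enorm.pow_const _
  have hmw : AEMeasurable (fun x => ‖w x‖ₑ ^ q) μ := hw.enorm.pow_const _
  have hme : ∀ k, AEMeasurable (e k) μ := fun k => ((hu k).sub hw).enorm.pow_const _
  have hmb : ∀ k, AEMeasurable (b k) μ := fun k => ((hmu k).add hmw).const_mul _
  set S : ℝ≥0∞ := c * (I + I) with hS
  have hSt : S ≠ ⊤ := by finiteness
  have hbS : Tendsto (fun k => ∫⁻ x, b k x ∂μ) atTop (𝓝 S) := by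
    have : ∀ k, ∫⁻ x, b k x ∂μ = c * (∫⁻ x, ‖u k x‖ₑ ^ q ∂μ + I) := fun k => by
      rw [hb, lintegral_const_mul' _ _ hct, lintegral_add_right' _ hmw]
    simp_rw [this]
    exact ENNReal.Tendsto.const_mul (hnorm.add_const I) (Or.inr hct)
  -- Fatou for `b k - e k ≥ 0`: both `∫ b k` and the pointwise limit of `b k - e k` give `S`, so
  -- nothing is left for `∫ e k` in the limit.
  have hfatou : S ≤ liminf (fun k => ∫⁻ x, (b k x - e k x) ∂μ) atTop := by
    refine le_trans (le_of_eq ?_) (lintegral_liminf_le' fun k => (hmb k).sub (hme k))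
    rw [hS, hI, ← lintegral_add_right' _ hmw, ← lintegral_const_mul' _ _ hct]
    refine lintegral_congr_ae ?_
    filter_upwards [hae] with x hx
    have h1 : Tendsto (fun k => ‖u k x‖ₑ ^ q) atTop (𝓝 (‖w x‖ₑ ^ q)) :=
      (ENNReal.continuous_rpow_const.tendsto _).comp ((continuous_enorm.tendsto _).comp hx)
    have h2 : Tendsto (fun k => e k x) atTop (𝓝 0) := by
      have h3 := (ENNReal.continuous_rpow_const (y := q).tendsto _).comp
        ((continuous_enorm.tendsto _).comp (hx.sub_const (w x)))
      rw [sub_self, enorm_zero, ENNReal.zero_rpow_of_pos hq] at h3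
      exact h3
    have h4 : Tendsto (fun k => b k x) atTop (𝓝 (c * (‖w x‖ₑ ^ q + ‖w x‖ₑ ^ q))) :=
      ENNReal.Tendsto.const_mul (h1.add_const _) (Or.inr hct)
    have h5 := ENNReal.Tendsto.sub h4 h2 (Or.inr ENNReal.zero_ne_top)
    rw [tsub_zero] at h5
    exact h5.liminf_eq.symm
  rw [ENNReal.tendsto_nhds_zero]
  intro δ hδ
  have hδ2 : 0 < δ / 2 := ENNReal.half_pos hδ.ne'
  have hev1 : ∀ᶠ k in atTop, S - δ / 2 ≤ ∫⁻ x, (b k x - e k x) ∂μ := by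
    by_cases h0 : S = 0
    · simp [h0]
    · exact (eventually_lt_of_lt_liminf
        ((ENNReal.sub_lt_self hSt h0 hδ2.ne').trans_le hfatou)).mono fun _ h => h.le
  have hev2 : ∀ᶠ k in atTop, ∫⁻ x, b k x ∂μ ≤ S + δ / 2 := by
    by_cases hδt : δ = ⊤
    · simp [hδt, ENNReal.top_div]
    · exact (hbS.eventually (gt_mem_nhds (ENNReal.lt_add_right hSt hδ2.ne'))).mono
        fun _ h => h.le
  filter_upwards [hev1, hev2] with k h1 h2
  have hsum : ∫⁻ x, e k x ∂μ + ∫⁻ x, (b k x - e k x) ∂μ = ∫⁻ x, b k x ∂μ := by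
    rw [← lintegral_add_left' (hme k)]
    exact lintegral_congr fun x => add_tsub_cancel_of_le (hle k x)
  refine (ENNReal.add_le_add_iff_right hSt).1 ?_
  calc ∫⁻ x, e k x ∂μ + S ≤ ∫⁻ x, e k x ∂μ + ((S - δ / 2) + δ / 2) := by
        gcongr; exact le_tsub_add
    _ ≤ ∫⁻ x, e k x ∂μ + (∫⁻ x, (b k x - e k x) ∂μ + δ / 2) := by gcongr
    _ = ∫⁻ x, b k x ∂μ + δ / 2 := by rw [← add_assoc, hsum]
    _ ≤ S + δ / 2 + δ / 2 := by gcongr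
    _ = δ + S := by rw [add_assoc, ENNReal.add_halves, add_comm]

/-- Convergence in measure and convergence of the norms imply strong convergence. -/
theorem tendsto_eLpNorm_sub_of_tendstoInMeasure {α : Type*} [MeasurableSpace α] {μ : Measure α}
    {q : ℝ≥0} (hq : 0 < q) {u : ℕ → α → ℝ} {w : α → ℝ} (hu : ∀ k, AEStronglyMeasurable (u k) μ)
    (hw : MemLp w q μ) (hm : TendstoInMeasure μ u atTop w)
    (hnorm : Tendsto (fun k => eLpNorm (u k) q μ) atTop (𝓝 (eLpNorm w q μ))) :
    Tendsto (fun k => eLpNorm (u k - w) q μ) atTop (𝓝 0) := by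
  have hQ : (0 : ℝ) < q := hq
  -- It suffices that each subsequence has a further one that converges, and the further one may be
  -- taken almost everywhere convergent.
  refine tendsto_of_subseq_tendsto fun ns hns => ?_
  have hm' : TendstoInMeasure μ (fun k => u (ns k)) atTop w := fun ε hε => (hm ε hε).comp hns
  obtain ⟨ms, hms, hae⟩ := hm'.exists_seq_tendsto_ae
  refine ⟨ms, ?_⟩
  have hpow : ∀ f : α → ℝ, eLpNorm f q μ = (∫⁻ x, ‖f x‖ₑ ^ (q : ℝ) ∂μ) ^ (q : ℝ)⁻¹ := fun f => by
    rw [← eLpNorm_nnreal_pow_eq_lintegral hq.ne', ENNReal.rpow_rpow_inv hQ.ne']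
  have hwf : ∫⁻ x, ‖w x‖ₑ ^ (q : ℝ) ∂μ ≠ ⊤ := by
    rw [← eLpNorm_nnreal_pow_eq_lintegral hq.ne']
    exact ENNReal.rpow_ne_top_of_nonneg hQ.le hw.eLpNorm_ne_top
  have hn : Tendsto (fun k => ∫⁻ x, ‖u (ns (ms k)) x‖ₑ ^ (q : ℝ) ∂μ) atTop
      (𝓝 (∫⁻ x, ‖w x‖ₑ ^ (q : ℝ) ∂μ)) := by
    simp_rw [← eLpNorm_nnreal_pow_eq_lintegral hq.ne']
    exact (ENNReal.continuous_rpow_const.tendsto _).comp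
      (hnorm.comp (hns.comp hms.tendsto_atTop))
  have h0 := tendsto_lintegral_enorm_sub_of_ae hQ (fun k => hu (ns (ms k)))
    hw.aestronglyMeasurable hwf hae hn
  have h1 := (ENNReal.continuous_rpow_const (y := (q : ℝ)⁻¹).tendsto _).comp h0
  rw [ENNReal.zero_rpow_of_pos (by positivity)] at h1
  refine h1.congr fun k => ?_
  rw [hpow]
  rfl

/-! ### Diffuse limits and compactness at the Sobolev exponent. -/

namespace Torus

variable {n : ℕ}

theorem lintegral_density_abs_rpow {s : ℝ} (hs : 0 ≤ s) {h : Torus n → ℝ}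
    (hh : AEStronglyMeasurable h volume) {φ : Torus n → ℝ≥0∞} (hφ : Measurable φ) :
    ∫⁻ x, φ x ∂density (fun x => |h x| ^ s) = ∫⁻ x, ‖h x‖ₑ ^ s * φ x := by
  have e : (fun x => ENNReal.ofReal (|h x| ^ s)) = fun x => ‖h x‖ₑ ^ s := by
    funext x
    rw [← ENNReal.ofReal_rpow_of_nonneg (abs_nonneg _) hs, Real.enorm_eq_ofReal_abs]
  rw [density, e, lintegral_withDensity_eq_lintegral_mul₀ (hh.enorm.pow_const _)
    hφ.aemeasurable]
  rfl

theorem isFiniteMeasure_density_abs_rpow {s : ℝ≥0} (hs : s ≠ 0) {h : Torus n → ℝ}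
    (hh : MemLp h s volume) : IsFiniteMeasure (density fun x => |h x| ^ (s : ℝ)) := by
  refine ⟨?_⟩
  rw [← lintegral_one, lintegral_density_abs_rpow s.coe_nonneg hh.aestronglyMeasurable
    measurable_const]
  simp_rw [mul_one]
  rw [← eLpNorm_nnreal_pow_eq_lintegral hs]
  exact ENNReal.rpow_lt_top_of_nonneg s.coe_nonneg hh.eLpNorm_ne_top

/-- Finiteness of the measures makes continuous functions integrable, so Bochner and Lebesgue
integrals agree; nonnegative test functions suffice to identify finite measures. -/
theorem WeakStarTendsto.tendsto_lintegral {ν : ℕ → Measure (Torus n)} {μ : Measure (Torus n)}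
    (h : WeakStarTendsto ν μ) (hν : ∀ k, IsFiniteMeasure (ν k)) [IsFiniteMeasure μ]
    (φ : BoundedContinuousFunction (Torus n) ℝ≥0) :
    Tendsto (fun k => ∫⁻ x, φ x ∂ν k) atTop (𝓝 (∫⁻ x, φ x ∂μ)) := by
  let Φ : C(Torus n, ℝ) := ⟨fun x => (φ x : ℝ), NNReal.continuous_coe.comp φ.continuous⟩
  have key : ∀ (ρ : Measure (Torus n)) [IsFiniteMeasure ρ],
      ∫⁻ x, φ x ∂ρ = ENNReal.ofReal (∫ x, Φ x ∂ρ) := fun ρ _ =>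
    lintegral_coe_eq_integral _ (Φ.continuous.integrable_of_hasCompactSupport
      (HasCompactSupport.of_compactSpace _))
  rw [key μ]
  refine (ENNReal.tendsto_ofReal (h Φ)).congr fun k => ?_
  have := hν k
  exact (key (ν k)).symm

/-- If `|h j|^p dx` converges to a diffuse measure, the `L^p` norms of the `h j` on small balls are
eventually uniformly small. -/
theorem IsDiffuse.exists_radius {γ : Measure (Torus n)} [IsFiniteMeasure γ] (hγ : IsDiffuse γ)
    {p : ℝ≥0} (hp : 0 < p) {h : ℕ → Torus n → ℝ} (hh : ∀ j, MemLp (h j) p volume)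
    (hconv : WeakStarTendsto (fun j => density fun x => |h j x| ^ (p : ℝ)) γ) {a : ℝ≥0}
    (ha : 0 < a) :
    ∃ r : ℝ, 0 < r ∧ r ≤ 1 / 4 ∧
      ∀ᶠ j in atTop, ∀ y, eLpNorm (fun t => bump r (t - y) * h j t) p volume ≤ a := by
  have hP : (0 : ℝ) < p := hp
  set e : ℝ≥0∞ := (a : ℝ≥0∞) ^ (p : ℝ) with he
  have he0 : 0 < e := ENNReal.rpow_pos (by exact_mod_cast ha) ENNReal.coe_ne_top
  have hball : ∀ x : Torus n, ∃ s : ℝ, 0 < s ∧ γ (Metric.ball x s) < e := by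
    intro x
    obtain ⟨U, hU, hUo, hUe⟩ := Set.exists_isOpen_lt_of_lt {x} e (by rw [hγ x]; exact he0)
    obtain ⟨s, hs, hsU⟩ := Metric.isOpen_iff.1 hUo x (hU rfl)
    exact ⟨s, hs, (measure_mono hsU).trans_lt hUe⟩
  choose s hs hsγ using hball
  -- A continuous function between the indicators of the balls of radii `s x / 2` and `s x`, so that
  -- smallness of `γ` near `x` passes to the approximating measures.
  let χ : Torus n → BoundedContinuousFunction (Torus n) ℝ≥0 := fun x =>
    thickenedIndicator (half_pos (hs x)) (Metric.ball x (s x / 2))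
  have hχγ : ∀ x, ∫⁻ t, χ x t ∂γ < e := by
    intro x
    refine lt_of_le_of_lt ?_ (hsγ x)
    rw [← lintegral_indicator_one Metric.isOpen_ball.measurableSet]
    refine lintegral_mono fun t => ?_
    by_cases ht : t ∈ Metric.ball x (s x)
    · rw [Set.indicator_of_mem ht]
      exact ENNReal.coe_le_one_iff.2 (thickenedIndicator_le_one _ _ t)
    · have : t ∉ Metric.thickening (s x / 2) (Metric.ball x (s x / 2)) := fun h => by
        obtain ⟨y, hy, hty⟩ := Metric.mem_thickening_iff.1 h
        refine ht (Metric.mem_ball.2 ((dist_triangle t y x).trans_lt ?_))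
        linarith [Metric.mem_ball.1 hy]
      simp [χ, thickenedIndicator_zero _ _ this]
  obtain ⟨F, -, hF⟩ := isCompact_univ.elim_nhds_subcover (fun x => Metric.ball x (s x / 4))
    fun x _ => Metric.ball_mem_nhds x (by linarith [hs x])
  -- A centre `y` lies within `s x / 4` of some `x ∈ F`, and the bump at `y` vanishes beyond
  -- distance `2 * r < s x / 4`; it is therefore dominated by `χ x`, and finitely many test
  -- functions serve all `y`.
  obtain ⟨r, ⟨hrF, hr4⟩, hr⟩ : ∃ r : ℝ, ((∀ x ∈ F, r < s x / 8) ∧ r < 1 / 4) ∧ 0 < r := by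
    have h1 : ∀ᶠ r in 𝓝[>] (0 : ℝ), ∀ x ∈ F, r < s x / 8 := by
      rw [Filter.eventually_all_finset]
      intro x _
      exact (gt_mem_nhds (by linarith [hs x])).filter_mono nhdsWithin_le_nhds
    have h2 : ∀ᶠ r in 𝓝[>] (0 : ℝ), r < 1 / 4 :=
      (gt_mem_nhds (by norm_num)).filter_mono nhdsWithin_le_nhds
    exact ((h1.and h2).and self_mem_nhdsWithin).exists
  refine ⟨r, hr, hr4.le, ?_⟩
  have hev : ∀ᶠ j in atTop, ∀ x ∈ F,
      ∫⁻ t, χ x t ∂density (fun t => |h j t| ^ (p : ℝ)) < e := by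
    rw [Filter.eventually_all_finset]
    intro x _
    exact (hconv.tendsto_lintegral (fun j => isFiniteMeasure_density_abs_rpow hp.ne' (hh j))
      (χ x)).eventually (gt_mem_nhds (hχγ x))
  filter_upwards [hev] with j hj y
  obtain ⟨x, hxF, hyx⟩ := Set.mem_iUnion₂.1 (hF (Set.mem_univ y))
  rw [← ENNReal.rpow_le_rpow_iff hP, eLpNorm_nnreal_pow_eq_lintegral hp.ne']
  refine le_trans ?_ (hj x hxF).le
  rw [lintegral_density_abs_rpow hP.le (hh j).aestronglyMeasurable
    (χ x).continuous.measurable.coe_nnreal_ennreal]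
  refine lintegral_mono fun t => ?_
  rw [enorm_mul, ENNReal.mul_rpow_of_nonneg _ _ hP.le, mul_comm]
  gcongr
  by_cases ht : ‖t - y‖ < 2 * r
  · have htx : t ∈ Metric.ball x (s x / 2) := by
      rw [Metric.mem_ball] at hyx ⊢
      have h1 := dist_triangle t y x
      rw [dist_eq_norm t y] at h1
      have h2 := hrF x hxF
      linarith
    rw [show χ x t = 1 from thickenedIndicator_one _ _ htx, ENNReal.coe_one]
    refine ENNReal.rpow_le_one ?_ hP.le
    rw [Real.enorm_eq_ofReal (bump_nonneg _ _)]
    exact ENNReal.ofReal_le_one.2 (bump_le_one _ _)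
  · rw [bump_eq_zero hr hr4.le (not_lt.1 ht)]
    simp [hp]

/-- The Sobolev embedding on the torus. -/
theorem MemSobolev.memLp_sobolevExponent (hn : 0 < n) {p q : ℝ≥0} (hp : 1 ≤ p)
    (hpq : (q : ℝ)⁻¹ = (p : ℝ)⁻¹ - (n : ℝ)⁻¹) (hplt : p < q) {w : Torus n → ℝ}
    {G : Torus n → EuclideanSpace ℝ (Fin n)} (hw : MemSobolev p w G) : MemLp w q volume := by
  -- Any direction and radius will do: a small multiple `t • w` meets all the thresholds, so its
  -- `L^q` norm is finite, and hence so is that of `w`.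
  obtain ⟨a, ha, H⟩ := MemSobolev.exists_eLpNorm_le_of_localized hn hp hpq hplt
    (EuclideanSpace.single ⟨0, hn⟩ 1) (by simp) 1 one_pos
  obtain ⟨d, hd, H⟩ := H (1 / 4) (by norm_num) le_rfl
  set B : ℝ≥0∞ := eLpNorm w p volume + eLpNorm G p volume with hB
  have hBt : B ≠ ⊤ := ENNReal.add_ne_top.2 ⟨hw.memLp.eLpNorm_ne_top, hw.memLp_grad.eLpNorm_ne_top⟩
  obtain ⟨t, ht, htB⟩ := ENNReal.exists_pos_mul_rpow_le hBt
    (show (0 : ℝ≥0∞) < (min 1 (min a d) : ℝ≥0) by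
      exact_mod_cast lt_min one_pos (lt_min ha hd)) one_pos
  rw [ENNReal.rpow_one] at htB
  have hsc : ∀ {F : Type} [NormedAddCommGroup F] [NormedSpace ℝ F] (f : Torus n → F) (s : ℝ≥0∞),
      eLpNorm ((t : ℝ) • f) s volume = t * eLpNorm f s volume := fun f s => by
    rw [eLpNorm_const_smul, Real.enorm_eq_ofReal t.coe_nonneg, ENNReal.ofReal_coe_nnreal]
  have hGt : eLpNorm ((t : ℝ) • G) p volume ≤ (min 1 (min a d) : ℝ≥0) := by
    rw [hsc, mul_comm]
    exact (mul_le_mul_left le_add_self _).trans htB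
  have hwt : eLpNorm ((t : ℝ) • w) p volume ≤ (min 1 (min a d) : ℝ≥0) := by
    rw [hsc, mul_comm]
    exact (mul_le_mul_left le_self_add _).trans htB
  have h1 := H _ _ (hw.const_smul t)
    (hGt.trans (by exact_mod_cast min_le_left _ _))
    (fun y => by
      refine (eLpNorm_mono fun x => ?_).trans (hGt.trans
        (by exact_mod_cast (min_le_right _ _).trans (min_le_left _ _)))
      rw [norm_mul, Real.norm_of_nonneg (bump_nonneg _ _)]
      refine (mul_le_of_le_one_left (norm_nonneg _) (bump_le_one _ _)).trans ?_
      simpa using norm_inner_le_norm (𝕜 := ℝ) (((t : ℝ) • G) x) (EuclideanSpace.single ⟨0, hn⟩ 1))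
    (hwt.trans (by exact_mod_cast (min_le_right _ _).trans (min_le_right _ _)))
  refine ⟨hw.memLp.aestronglyMeasurable, lt_top_iff_ne_top.2 fun htop => ?_⟩
  rw [hsc, htop, ENNReal.mul_top (by exact_mod_cast ht.ne')] at h1
  simp at h1

/-- If the `p`-th powers of one directional derivative converge to a diffuse measure, a subsequence
converges strongly at the Sobolev exponent. -/
theorem exists_subseq_tendsto_sobolevExponent (hn : 0 < n) {p q : ℝ≥0} (hp : 1 ≤ p)
    (hpq : (q : ℝ)⁻¹ = (p : ℝ)⁻¹ - (n : ℝ)⁻¹) (hplt : p < q) {u : ℕ → Torus n → ℝ}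
    {Du : ℕ → Torus n → EuclideanSpace ℝ (Fin n)} (hu : ∀ k, MemSobolev p (u k) (Du k)) {C : ℝ≥0}
    (hC : ∀ k, sobolevNorm p (u k) (Du k) ≤ C) {v : EuclideanSpace ℝ (Fin n)} (hv : ‖v‖ = 1)
    {γ : Measure (Torus n)} [IsFiniteMeasure γ] (hγ : IsDiffuse γ)
    (hγconv : WeakStarTendsto (fun j => density fun x => |inner ℝ (Du j x) v| ^ (p : ℝ)) γ) :
    ∃ (σ : ℕ → ℕ) (U : Torus n → ℝ), StrictMono σ ∧ MemLp U q volume ∧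
      Tendsto (fun j => eLpNorm (u (σ j) - U) q volume) atTop (𝓝 0) := by
  have hp1 : (1 : ℝ≥0∞) ≤ p := by exact_mod_cast hp
  have hp0 : (p : ℝ≥0∞) ≠ 0 := (zero_lt_one.trans_le hp1).ne'
  have hpos : ∀ {x : ℝ≥0}, 0 < x → (0 : ℝ≥0∞) < x := fun h => by exact_mod_cast h
  obtain ⟨σ, U, hσ, hU, hlim⟩ := exists_subseq_tendsto_of_memSobolev hp hu hC
  have hmU := hU.aestronglyMeasurable
  have hmu : ∀ k, AEStronglyMeasurable (u k) volume := fun k => (hu k).memLp.aestronglyMeasurable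
  have hmD : ∀ k, AEStronglyMeasurable (Du k) volume :=
    fun k => (hu k).memLp_grad.aestronglyMeasurable
  have hmv : ∀ k, MemLp (fun x => inner ℝ (Du k x) v) p volume := fun k =>
    (hu k).memLp_grad.mono ((hmD k).inner aestronglyMeasurable_const)
      (.of_forall fun x => by simpa [hv] using norm_inner_le_norm (𝕜 := ℝ) (Du k x) v)
  obtain ⟨ns, hns, hae⟩ := (tendstoInMeasure_of_tendsto_eLpNorm hp0
    (fun j => hmu (σ j)) hmU hlim).exists_seq_tendsto_ae
  have hq : Tendsto (fun j => eLpNorm (u (σ j) - U) q volume) atTop (𝓝 0) := by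
    rw [ENNReal.tendsto_nhds_zero]
    intro ε' hε'
    obtain ⟨ε, hε, hεε'⟩ := ENNReal.lt_iff_exists_nnreal_btwn.1 hε'
    have hε0 : 0 < ε := by exact_mod_cast hε
    obtain ⟨a, ha, H⟩ := MemSobolev.exists_eLpNorm_le_of_localized hn hp hpq hplt v hv (C + C) hε0
    obtain ⟨r, hr, hr', hloc⟩ := hγ.exists_radius (zero_lt_one.trans_le hp) hmv hγconv (half_pos ha)
    obtain ⟨d, hd, H⟩ := H r hr hr'
    obtain ⟨J, hJ⟩ := eventually_atTop.1 ((hσ.tendsto_atTop.eventually hloc).and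
      (ENNReal.tendsto_nhds_zero.1 hlim (d / 2 : ℝ≥0) (hpos (half_pos hd))))
    -- The localized inequality is applied to differences, hence the gradient bound `C + C` and the
    -- halves of `a` and `d`. Letting `l → ∞` almost everywhere then bounds the distance to `U`.
    have hcauchy : ∀ j ≥ J, ∀ l ≥ J, eLpNorm (u (σ j) - u (σ l)) q volume ≤ ε := by
      intro j hj l hl
      refine H _ _ ((hu (σ j)).sub hp1 (hu (σ l))) ?_ (fun y => ?_) ?_
      · refine (eLpNorm_sub_le (hmD _) (hmD _) hp1).trans ?_
        push_cast
        exact add_le_add (le_add_self.trans (hC _)) (le_add_self.trans (hC _))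
      · have hb : AEStronglyMeasurable (fun t : Torus n => bump r (t - y)) volume :=
          ((continuous_bump r).comp (continuous_id.sub continuous_const)).aestronglyMeasurable
        have e : (fun t => bump r (t - y) * inner ℝ ((Du (σ j) - Du (σ l)) t) v) =
            (fun t => bump r (t - y) * inner ℝ (Du (σ j) t) v) -
              fun t => bump r (t - y) * inner ℝ (Du (σ l) t) v := by
          funext t
          simp [inner_sub_left, mul_sub]
        rw [e]
        refine (eLpNorm_sub_le (hb.mul (hmv _).aestronglyMeasurable)
          (hb.mul (hmv _).aestronglyMeasurable) hp1).trans ?_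
        refine (add_le_add ((hJ j hj).1 y) ((hJ l hl).1 y)).trans (le_of_eq ?_)
        rw [← ENNReal.coe_add, add_halves]
      · have e : u (σ j) - u (σ l) = (u (σ j) - U) - (u (σ l) - U) := by abel
        rw [e]
        refine (eLpNorm_sub_le ((hmu _).sub hmU) ((hmu _).sub hmU) hp1).trans ?_
        refine (add_le_add (hJ j hj).2 (hJ l hl).2).trans (le_of_eq ?_)
        rw [← ENNReal.coe_add, add_halves]
    filter_upwards [eventually_ge_atTop J] with j hj
    refine le_trans ?_ hεε'.le
    refine Lp.eLpNorm_le_of_ae_tendsto (u := atTop) (f := fun m => u (σ j) - u (σ (ns m))) ?_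
      (fun m => (hmu _).sub (hmu _)) ?_
    · filter_upwards [hns.tendsto_atTop.eventually (eventually_ge_atTop J)] with m hm
      exact hcauchy j hj _ hm
    · filter_upwards [hae] with x hx
      exact hx.const_sub _
  refine ⟨σ, U, hσ, ?_, hq⟩
  obtain ⟨j, hj⟩ := (ENNReal.tendsto_nhds_zero.1 hq 1 one_pos).exists
  have h1 : MemLp (u (σ j) - U) q volume :=
    ⟨(hmu _).sub hmU, hj.trans_lt ENNReal.one_lt_top⟩
  have h2 := ((hu (σ j)).memLp_sobolevExponent hn hp hpq hplt).sub h1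
  rwa [sub_sub_cancel] at h2

/-- Strong convergence in `L^q` identifies the weak-star limit of the `q`-th powers. -/
theorem tendsto_lintegral_density_abs_rpow {q : ℝ≥0} (hq : 1 ≤ q) {u : ℕ → Torus n → ℝ}
    {U : Torus n → ℝ} (hu : ∀ j, MemLp (u j) q volume) (hU : MemLp U q volume)
    (h : Tendsto (fun j => eLpNorm (u j - U) q volume) atTop (𝓝 0))
    (φ : BoundedContinuousFunction (Torus n) ℝ≥0) :
    Tendsto (fun j => ∫⁻ x, φ x ∂density fun x => |u j x| ^ (q : ℝ)) atTop
      (𝓝 (∫⁻ x, φ x ∂density fun x => |U x| ^ (q : ℝ))) := by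
  have hq0 : q ≠ 0 := (zero_lt_one.trans_le hq).ne'
  -- The integral of `φ |f|^q` is the `q`-th power of the norm of `f` in `L^q(φ dx)`, so convergence
  -- of norms for this weighted measure is enough.
  let l : Measure (Torus n) := volume.withDensity fun x => (φ x : ℝ≥0∞)
  have hmφ : Measurable fun x => (φ x : ℝ≥0∞) := φ.continuous.measurable.coe_nnreal_ennreal
  have hac : l ≪ volume := withDensity_absolutelyContinuous _ _
  obtain ⟨K, hK⟩ : ∃ K : ℝ≥0, ∀ x, φ x ≤ K := by
    obtain ⟨K, hK⟩ := isCompact_univ.exists_bound_of_continuousOn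
      (NNReal.continuous_coe.comp φ.continuous).continuousOn
    exact ⟨K.toNNReal, fun x => NNReal.coe_le_coe.1
      ((le_abs_self _).trans ((hK x trivial).trans (Real.le_coe_toNNReal K)))⟩
  have hl : l ≤ (K : ℝ≥0∞) • volume := by
    rw [← withDensity_const]
    exact withDensity_mono (.of_forall fun x => ENNReal.coe_le_coe.2 (hK x))
  have key : ∀ f : Torus n → ℝ, AEStronglyMeasurable f volume →
      ∫⁻ x, φ x ∂density (fun x => |f x| ^ (q : ℝ)) = eLpNorm f q l ^ (q : ℝ) := by
    intro f hf
    rw [lintegral_density_abs_rpow q.coe_nonneg hf hmφ, eLpNorm_nnreal_pow_eq_lintegral hq0,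
      lintegral_withDensity_eq_lintegral_mul₀ hmφ.aemeasurable (hf.enorm.pow_const _)]
    exact lintegral_congr fun x => mul_comm _ _
  have hbd : ∀ f : Torus n → ℝ, eLpNorm f q l ≤
      (K : ℝ≥0∞) ^ (1 / (q : ℝ≥0∞)).toReal * eLpNorm f q volume := fun f =>
    (eLpNorm_mono_measure _ hl).trans (eLpNorm_smul_measure_le _ _ _ _)
  have hKt : (K : ℝ≥0∞) ^ (1 / (q : ℝ≥0∞)).toReal ≠ ⊤ := by finiteness
  have hUl : MemLp U q l := ⟨hU.aestronglyMeasurable.mono_ac hac,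
    (hbd U).trans_lt (ENNReal.mul_lt_top hKt.lt_top hU.eLpNorm_lt_top)⟩
  have hlim : Tendsto (fun j => eLpNorm (u j - U) q l) atTop (𝓝 0) := by
    have h1 := ENNReal.Tendsto.const_mul h (Or.inr hKt)
    rw [mul_zero] at h1
    exact tendsto_of_tendsto_of_tendsto_of_le_of_le tendsto_const_nhds h1 (fun _ => bot_le)
      fun j => hbd _
  rw [key U hU.aestronglyMeasurable]
  simp_rw [fun j => key (u j) (hu j).aestronglyMeasurable]
  exact (ENNReal.continuous_rpow_const.tendsto _).comp
    (tendsto_eLpNorm_of_tendsto_eLpNorm_sub (by exact_mod_cast hq)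
      (fun j => (hu j).aestronglyMeasurable.mono_ac hac) hUl hlim)

end Torus

end

/-! ### The main theorem. -/

theorem corollary1p5 (n : ℕ) (p : ℝ) (hp : 1 ≤ p) (hpn : p < n)
    (u : ℕ → Torus n → ℝ) (Du : ℕ → Torus n → EuclideanSpace ℝ (Fin n))
    (hu : ∀ k, Torus.MemSobolev (ENNReal.ofReal p) (u k) (Du k))
    (hbdd : ∃ C : ℝ≥0, ∀ k, Torus.sobolevNorm (ENNReal.ofReal p) (u k) (Du k) ≤ C)
    (g : Torus n → ℝ) (hg : Integrable g volume) (hg_nonneg : 0 ≤ᵐ[volume] g)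
    (μs : Measure (Torus n)) [IsFiniteMeasure μs] (hμs : μs ⟂ₘ volume)
    (hconv : Torus.WeakStarTendsto
      (fun k => Torus.density (fun x => |u k x| ^ sobolevExponent n p))
      (Torus.density g + μs))
    (v : EuclideanSpace ℝ (Fin n)) (hv : ‖v‖ = 1)
    (κ : ℕ → ℕ) (hκ : StrictMono κ)
    (γ : Measure (Torus n)) [IsFiniteMeasure γ] (hγ : Torus.IsDiffuse γ)
    (hγconv : Torus.WeakStarTendsto
      (fun j => Torus.density (fun x => |inner ℝ (Du (κ j) x) v| ^ p)) γ) :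
    μs = 0 ∧
      ∀ w : Torus n → ℝ,
        Torus.WeakLpTendsto (ENNReal.ofReal (sobolevExponent n p)) u w →
        Torus.StrongLpTendsto 1 u w →
        Torus.StrongLpTendsto (ENNReal.ofReal (sobolevExponent n p)) u w := by
  have hp0 : 0 < p := by linarith
  have hn0 : (0 : ℝ) < n := by linarith
  have hn : 0 < n := by exact_mod_cast hn0
  have hnp : 0 < (n : ℝ) - p := by linarith
  have hq0 : 0 < sobolevExponent n p := by unfold sobolevExponent; positivity
  have hpq : (sobolevExponent n p)⁻¹ = p⁻¹ - (n : ℝ)⁻¹ := by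
    unfold sobolevExponent
    field_simp
  have hplt : p < sobolevExponent n p := by
    unfold sobolevExponent
    rw [lt_div_iff₀ hnp]
    nlinarith
  generalize sobolevExponent n p = q at *
  lift p to ℝ≥0 using hp0.le
  lift q to ℝ≥0 using hq0.le
  simp only [ENNReal.ofReal_coe_nnreal] at *
  replace hp : 1 ≤ p := by exact_mod_cast hp
  replace hplt : p < q := by exact_mod_cast hplt
  replace hq0 : 0 < q := by exact_mod_cast hq0
  have hq1 : 1 ≤ q := hp.trans hplt.le
  have hq0' : (q : ℝ≥0∞) ≠ 0 := by exact_mod_cast hq0.ne'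
  obtain ⟨C, hC⟩ := hbdd
  have huq : ∀ k, MemLp (u k) q volume := fun k =>
    (hu k).memLp_sobolevExponent hn hp hpq hplt
  obtain ⟨σ, U, hσ, hU, hlim⟩ := Torus.exists_subseq_tendsto_sobolevExponent hn hp hpq hplt
    (fun j => hu (κ j)) (fun j => hC (κ j)) hv hγ hγconv
  have hfin : ∀ k, IsFiniteMeasure (Torus.density fun x => |u k x| ^ (q : ℝ)) := fun k =>
    Torus.isFiniteMeasure_density_abs_rpow hq0.ne' (huq k)
  have hgfin : IsFiniteMeasure (Torus.density g) := isFiniteMeasure_withDensity_ofReal hg.2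
  -- Along the subsequence `κ ∘ σ` the measures have two weak-star limits: the given one, and the
  -- one identified by strong convergence.
  have heq : Torus.density g + μs = Torus.density fun x => |U x| ^ (q : ℝ) := by
    refine ext_of_forall_lintegral_eq_of_IsFiniteMeasure fun φ => ?_
    exact tendsto_nhds_unique
      ((hconv.tendsto_lintegral hfin φ).comp (hκ.tendsto_atTop.comp hσ.tendsto_atTop))
      (Torus.tendsto_lintegral_density_abs_rpow hq1 (fun j => huq (κ (σ j))) hU hlim φ)
  refine ⟨?_, fun w _ hw => ⟨huq, ?_, ?_⟩⟩
  · have hac : μs ≪ volume := by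
      refine (Measure.absolutelyContinuous_of_le (Measure.le_add_left le_rfl)).trans
        (μ₂ := Torus.density g + μs) ?_
      rw [heq]
      exact withDensity_absolutelyContinuous _ _
    exact Measure.eq_zero_of_absolutelyContinuous_of_mutuallySingular hac hμs
  all_goals
    have hm1 : TendstoInMeasure volume u atTop w :=
      tendstoInMeasure_of_tendsto_eLpNorm one_ne_zero
        (fun k => (huq k).aestronglyMeasurable) hw.memLp_limit.aestronglyMeasurable hw.tendsto
    have hm2 : TendstoInMeasure volume (fun j => u (κ (σ j))) atTop U :=
      tendstoInMeasure_of_tendsto_eLpNorm hq0'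
        (fun k => (huq _).aestronglyMeasurable) hU.aestronglyMeasurable hlim
    have hUw : U =ᵐ[volume] w := tendstoInMeasure_ae_unique hm2
      fun ε hε => (hm1 ε hε).comp (hκ.tendsto_atTop.comp hσ.tendsto_atTop)
    have hwq : MemLp w q volume := hU.ae_eq hUw
  · exact hwq
  · refine tendsto_eLpNorm_sub_of_tendstoInMeasure hq0 (fun k => (huq k).aestronglyMeasurable)
      hwq hm1 ?_
    -- The weak-star hypothesis concerns the full sequence, so testing with `1` gives convergence of
    -- all the norms to that of `U`, not only along the subsequence.
    have h1 := hconv.tendsto_lintegral hfin 1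
    rw [heq] at h1
    have hnorm : ∀ f : Torus n → ℝ, AEStronglyMeasurable f volume →
        (∫⁻ x, ((1 : BoundedContinuousFunction (Torus n) ℝ≥0) x : ℝ≥0∞)
          ∂Torus.density fun x => |f x| ^ (q : ℝ)) ^ (q : ℝ)⁻¹ = eLpNorm f q volume := by
      intro f hf
      rw [Torus.lintegral_density_abs_rpow q.coe_nonneg hf (by simp)]
      simp only [BoundedContinuousFunction.coe_one, Pi.one_apply, ENNReal.coe_one, mul_one]
      rw [← eLpNorm_nnreal_pow_eq_lintegral hq0.ne', ENNReal.rpow_rpow_inv]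
      exact_mod_cast hq0.ne'
    have h2 := (ENNReal.continuous_rpow_const (y := (q : ℝ)⁻¹).tendsto _).comp h1
    rw [hnorm U hU.aestronglyMeasurable, eLpNorm_congr_ae hUw] at h2
    exact h2.congr fun k => hnorm (u k) (huq k).aestronglyMeasurable
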